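/- Let $d\ge 1$ be an integer and let $p\in[0,1]$. For $\mathbf m=(m_1,\dots,m_d)\in\mathbb N^d$ let $[\mathbf m]=\{1,\dots,m_1\}\times\cdots\times\{1,\dots,m_d\}\subset\mathbb Z^d$, which has $\#[\mathbf m]=m_1\cdots m_d$ points, and regard it as a graph in which two points $\mathbf x,\mathbf y$ are neighbors if and only if $\sum_{i}|x_i-y_i|=1$. For an integer $\ell\ge 0$ let $\#C([\mathbf m],\ell)$ be the number of monomer-dimer tilings of $[\mathbf m]$ with exactly $\ell$ dimers, i.e. the number of matchings with exactly $\ell$ edges in this graph. The $p$-monomer-dimer entropy of $\mathbb Z^d$ is $$\lambda_d(p)=\lim \frac{\log \#C([\mathbf m],\ell)}{\#[\mathbf m]}\qquad\text{as } m_1,\dots,m_d\to\infty,\quad \frac{2\ell}{\#[\mathbf m]}\to p,\quad 2\ell\le\#[\mathbf m].$$ (By a theorem of Hammersley this limit exists, so it equals the corresponding lower limit, which may be taken as the definition of $\lambda_d(p)$.) **Theorem.** The Lower Asymptotic Matching Conjecture holds for the lattice $\mathbb Z^d$: for every integer $d\ge 1$ and every $p\in[0,1]$, $$\lambda_d(p)\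 \ge\ \frac12\left[p\log(2d)-p\log p-2(1-p)\log(1-p)+(2d-p)\log\left(1-\frac{p}{2d}\right)\right],$$ where $0\log 0=0$. -/

import Mathlib

open Filter Topology

/-- The graph of the integer lattice `ℤ^d`: two points are neighbours when their
`ℓ¹`-distance is `1`. -/
def latticeGraph (d : ℕ) : SimpleGraph (Fin d → ℤ) where
  Adj x y := ∑ i, |x i - y i| = 1
  symm := ⟨fun x y h => by simpa only [abs_sub_comm] using h⟩
  loopless := ⟨fun x h => by simp at h⟩

/-- The box `[m] = [m_1] × ⋯ × [m_d]` in `ℤ^d`, where `[k] = {1, …, k}`. -/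
def latticeBox {d : ℕ} (m : Fin d → ℕ) : Set (Fin d → ℤ) :=
  {x | ∀ i, 1 ≤ x i ∧ x i ≤ m i}

/-- The box `[m]` as a graph: the induced subgraph of the lattice (free boundary). -/
def boxGraph {d : ℕ} (m : Fin d → ℕ) : SimpleGraph (latticeBox m) :=
  (latticeGraph d).induce (latticeBox m)

/-- The number `#C([m], ℓ)` of monomer-dimer tilings of the box `[m]` with exactly `ℓ` dimers,
that is, of matchings of the (finite) graph of the box that have exactly `ℓ` edges; the vertices
outside the matching are the monomers. -/
noncomputable def numTilings {d : ℕ} (m : Fin d → ℕ) (l : ℕ) : ℕ :=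
  {M : (boxGraph m).Subgraph | M.IsMatching ∧ M.edgeSet.ncard = l}.ncard

/-- The limiting regime in the definition of the entropy: pairs `(m, ℓ)` with `2ℓ ≤ #[m]`, as all
`m_k` tend to infinity and the dimer density `2ℓ / #[m]` tends to `p`. -/
noncomputable def densityFilter (d : ℕ) (p : ℝ) : Filter ((Fin d → ℕ) × ℕ) :=
  comap (fun x => x.1) (Filter.pi fun _ => atTop) ⊓
    comap (fun x => (2 * x.2 : ℝ) / ∏ i, (x.1 i : ℝ)) (𝓝 p) ⊓
    𝓟 {x | 2 * x.2 ≤ ∏ i, x.1 i}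

/-- The `p`-monomer-dimer entropy `λ_d(p)` of `ℤ^d`: the limit of `log #C([m], ℓ) / #[m]` as
`m → ∞` and `2ℓ / #[m] → p`. It is written as a lower limit, so that its value never depends on
whether the limit exists; `monomerDimerEntropy_eq_of_tendsto` below shows that it is the limit
along all admissible sequences `(m_i, ℓ_i)` whenever these have a common limit. There is no
undefined logarithm here: for `2ℓ ≤ #[m]` the box has a tiling with `ℓ` dimers, because it has a
Hamiltonian path. -/
noncomputable def monomerDimerEntropy (d : ℕ) (p : ℝ) : ℝ :=
  liminf (fun x : (Fin d → ℕ) × ℕ => Real.log (numTilings x.1 x.2) / ∏ i, (x.1 i : ℝ))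
    (densityFilter d p)

/-- A sequence runs along `densityFilter d p` exactly if it is admissible. -/
theorem tendsto_densityFilter_iff {d : ℕ} {p : ℝ} (s : ℕ → (Fin d → ℕ) × ℕ) :
    Tendsto s atTop (densityFilter d p) ↔
      (∀ k, Tendsto (fun i => (s i).1 k) atTop atTop) ∧
      Tendsto (fun i => (2 * (s i).2 : ℝ) / ∏ k, ((s i).1 k : ℝ)) atTop (𝓝 p) ∧
      ∀ᶠ i in atTop, 2 * (s i).2 ≤ ∏ k, (s i).1 k := by
  simp only [densityFilter, tendsto_inf, tendsto_comap_iff, tendsto_pi, tendsto_principal,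
    Function.comp_def, Set.mem_ofPred_eq, and_assoc]

/-- Admissible sequences exist for every density `p ∈ [0, 1]`. -/
theorem densityFilter_neBot {d : ℕ} (hd : 1 ≤ d) {p : ℝ} (hp : p ∈ Set.Icc (0 : ℝ) 1) :
    (densityFilter d p).NeBot := by
  have key : Tendsto (fun n : ℕ => ((fun _ => n, ⌊p / 2 * (n : ℝ) ^ d⌋₊) : (Fin d → ℕ) × ℕ))
      atTop (densityFilter d p) := by
    have hpow : Tendsto (fun n : ℕ => (n : ℝ) ^ d) atTop atTop :=
      (tendsto_pow_atTop (by omega)).comp tendsto_natCast_atTop_atTop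
    refine (tendsto_densityFilter_iff _).2 ⟨fun _ => tendsto_id, ?_, Eventually.of_forall ?_⟩
    · have h1 := ((tendsto_nat_floor_mul_div_atTop (R := ℝ) (a := p / 2)
        (by linarith [hp.1])).comp hpow).const_mul 2
      have h2 : (2 : ℝ) * (p / 2) = p := by ring
      rw [h2] at h1
      refine h1.congr fun n => ?_
      simp [mul_div_assoc]
    · intro n
      have h0 : (0 : ℝ) ≤ (n : ℝ) ^ d := by positivity
      have h1 : ((⌊p / 2 * (n : ℝ) ^ d⌋₊ : ℕ) : ℝ) ≤ p / 2 * (n : ℝ) ^ d :=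
        Nat.floor_le (mul_nonneg (by linarith [hp.1]) h0)
      have h2 : p * (n : ℝ) ^ d ≤ 1 * (n : ℝ) ^ d := mul_le_mul_of_nonneg_right hp.2 h0
      have h3 : (2 * ⌊p / 2 * (n : ℝ) ^ d⌋₊ : ℝ) ≤ (n : ℝ) ^ d := by linarith
      simpa using (by exact_mod_cast h3 : 2 * ⌊p / 2 * (n : ℝ) ^ d⌋₊ ≤ n ^ d)
  exact key.neBot

/-- If `log #C([m_i], ℓ_i) / #[m_i]` tends to the same number `L` along all admissible sequences,
then `L` is the entropy. -/
theorem monomerDimerEntropy_eq_of_tendsto {d : ℕ} (hd : 1 ≤ d) {p : ℝ}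
    (hp : p ∈ Set.Icc (0 : ℝ) 1) (L : ℝ)
    (h : ∀ (m : ℕ → Fin d → ℕ) (l : ℕ → ℕ), (∀ k, Tendsto (fun i => m i k) atTop atTop) →
      Tendsto (fun i => (2 * l i : ℝ) / ∏ k, (m i k : ℝ)) atTop (𝓝 p) →
      (∀ᶠ i in atTop, 2 * l i ≤ ∏ k, m i k) →
      Tendsto (fun i => Real.log (numTilings (m i) (l i)) / ∏ k, (m i k : ℝ)) atTop (𝓝 L)) :
    monomerDimerEntropy d p = L := by
  have := densityFilter_neBot hd hp
  have : (densityFilter d p).IsCountablyGenerated := by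
    unfold densityFilter
    infer_instance
  refine Tendsto.liminf_eq (tendsto_of_seq_tendsto fun s hs => ?_)
  obtain ⟨h1, h2, h3⟩ := (tendsto_densityFilter_iff s).1 hs
  exact h (fun i => (s i).1) (fun i => (s i).2) h1 h2 h3

/-! The proof rests on a Bethe-type lower bound for bipartite graphs (`prod_le_partitionFn`): if
dimer weights `a e` and monomer weights `s v` sum to 1 at every vertex, the weighted matching sum is
at least `∏ (1 - a e) ^ (1 - a e)`. Cut every edge into two half-edges carrying free variables.
Without edges the partition function is a product over vertices, and weighted AM-GM bounds it below
by a monomial. Gluing an edge back replaces a bilinear polynomial in its two variables by a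
combination of its extreme coefficients. By `capacity_le` this costs only the factor `(1 - α) ^ (1 -
α)`, provided the coefficients satisfy `B * C ≤ A * D`; that is the positive correlation of vertices
on opposite sides (`partitionFn_correlation`).

To fix the number of dimers, auxiliary vertices absorb the uncovered vertices of one colour
(`partitionFn_attach`). Their edges cost `exp (-a)`, and Stirling's formula leaves only a polynomial
loss (`prod_le_partitionFnDefect`).

On a box of volume `N`, take weight about `p / (2d)` on every lattice edge and `1 - p` on every
monomer. All matchings with `k ≈ pN/2` edges then have nearly the same weight, so dividing the Bethe
bound by it counts them: the entropy is at least `d (1 - p/2d) log (1 - p/2d) - (p/2) log (p/2d) -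
(1 - p) log (1 - p)`, which is the claimed expression. Boundary effects are confined to a layer of
vanishing density.

For `p < 1` the edges leaving the box can be dropped. For `p = 1` the fractional matching must be
perfect up to at most one site, so those edges are redirected along dominoes (`reflectingDarts`),
which needs `d ≥ 2`; for `d = 1`, `p = 1` the bound is 0. -/

/-! ### Weighted monomer-dimer partition functions and correlations. -/

section MonomerDimer

variable {V : Type*}

/-- A set of pairwise disjoint non-degenerate unordered pairs. -/
def IsPairing (M : Finset (Sym2 V)) : Prop :=
  (∀ e ∈ M, ¬ e.IsDiag) ∧ ∀ e ∈ M, ∀ f ∈ M, ∀ v, v ∈ e → v ∈ f → e = f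

open scoped Classical in
/-- The matchings of the complete graph on `S`. -/
noncomputable def pairings (S : Finset V) : Finset (Finset (Sym2 V)) :=
  S.sym2.powerset.filter IsPairing

theorem mem_pairings {S : Finset V} {M : Finset (Sym2 V)} :
    M ∈ pairings S ↔ (∀ e ∈ M, ∀ v ∈ e, v ∈ S) ∧ IsPairing M := by
  simp only [pairings, Finset.mem_filter, Finset.mem_powerset, Finset.subset_iff,
    Finset.mem_sym2_iff]

variable [DecidableEq V]

/-- The vertices of `S` that are not covered by `M`. -/
def uncovered (S : Finset V) (M : Finset (Sym2 V)) : Finset V :=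
  S.filter fun v => ∀ e ∈ M, v ∉ e

/-- The monomer-dimer partition function with dimer weights `w` and monomer weights `r`. -/
noncomputable def partitionFn (w : Sym2 V → ℝ) (r : V → ℝ) (S : Finset V) : ℝ :=
  ∑ M ∈ pairings S, (∏ e ∈ M, w e) * ∏ v ∈ uncovered S M, r v

theorem mem_uncovered {S : Finset V} {M : Finset (Sym2 V)} {v : V} :
    v ∈ uncovered S M ↔ v ∈ S ∧ ∀ e ∈ M, v ∉ e := by
  simp [uncovered]

theorem mem_pairings_erase {S : Finset V} {M : Finset (Sym2 V)} {u : V} :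
    M ∈ pairings (S.erase u) ↔ M ∈ pairings S ∧ ∀ e ∈ M, u ∉ e := by
  simp only [mem_pairings, Finset.mem_erase]
  grind

theorem notMem_of_mem_pairings_erase {S : Finset V} {M : Finset (Sym2 V)} {u : V}
    (hM : M ∈ pairings (S.erase u)) : ∀ e ∈ M, u ∉ e :=
  (mem_pairings_erase.1 hM).2

theorem insert_mem_pairings {S : Finset V} {M : Finset (Sym2 V)} {u x : V} (hu : u ∈ S)
    (hx : x ∈ S.erase u) (hM : M ∈ pairings ((S.erase u).erase x)) :
    insert s(u, x) M ∈ pairings S := by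
  rw [mem_pairings_erase, mem_pairings_erase, mem_pairings] at hM
  obtain ⟨⟨⟨h1, h2, h3⟩, h4⟩, h5⟩ := hM
  rw [Finset.mem_erase] at hx
  rw [mem_pairings]
  refine ⟨?_, ?_, ?_⟩
  · intro e he v hv
    rw [Finset.mem_insert] at he
    rcases he with rfl | he
    · rw [Sym2.mem_iff] at hv
      rcases hv with rfl | rfl
      exacts [hu, hx.2]
    · exact h1 e he v hv
  · intro e he
    rw [Finset.mem_insert] at he
    rcases he with rfl | he
    · simpa using hx.1.symm
    · exact h2 e he
  · intro e he f hf v hve hvf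
    rw [Finset.mem_insert] at he hf
    rcases he with rfl | he <;> rcases hf with rfl | hf
    · rfl
    · rw [Sym2.mem_iff] at hve
      rcases hve with rfl | rfl
      exacts [absurd hvf (h4 f hf), absurd hvf (h5 f hf)]
    · rw [Sym2.mem_iff] at hvf
      rcases hvf with rfl | rfl
      exacts [absurd hve (h4 e he), absurd hve (h5 e he)]
    · exact h3 e he f hf v hve hvf

theorem erase_mem_pairings {S : Finset V} {M : Finset (Sym2 V)} {u x : V}
    (hM : M ∈ pairings S) (he : s(u, x) ∈ M) :
    M.erase s(u, x) ∈ pairings ((S.erase u).erase x) := by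
  rw [mem_pairings] at hM
  obtain ⟨h1, h2, h3⟩ := hM
  rw [mem_pairings_erase, mem_pairings_erase, mem_pairings]
  refine ⟨⟨⟨?_, ?_, ?_⟩, ?_⟩, ?_⟩
  · exact fun e h => h1 e (Finset.mem_of_mem_erase h)
  · exact fun e h => h2 e (Finset.mem_of_mem_erase h)
  · exact fun e h f h' => h3 e (Finset.mem_of_mem_erase h) f (Finset.mem_of_mem_erase h')
  · intro f hf hu
    rw [Finset.mem_erase] at hf
    exact hf.1 (h3 f hf.2 _ he u hu (Sym2.mem_mk_left u x))
  · intro f hf hu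
    rw [Finset.mem_erase] at hf
    exact hf.1 (h3 f hf.2 _ he x hu (Sym2.mem_mk_right u x))

/-- Splitting matchings according to the partner of the vertex `u`. -/
theorem sum_pairings (F : Finset (Sym2 V) → ℝ) {S : Finset V} {u : V} (hu : u ∈ S) :
    ∑ M ∈ pairings S, F M = ∑ M ∈ pairings (S.erase u), F M +
      ∑ x ∈ S.erase u, ∑ M ∈ pairings ((S.erase u).erase x), F (insert s(u, x) M) := by
  classical
  rw [← Finset.sum_filter_add_sum_filter_not (pairings S) (fun M => ∀ e ∈ M, u ∉ e)]
  congr 1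
  · refine Finset.sum_congr ?_ fun _ _ => rfl
    ext M
    rw [Finset.mem_filter, mem_pairings_erase]
  · rw [Finset.sum_sigma']
    symm
    refine Finset.sum_bij (fun p _ => insert s(u, p.1) p.2) ?_ ?_ ?_ ?_
    · rintro ⟨x, M⟩ h
      rw [Finset.mem_sigma] at h
      rw [Finset.mem_filter]
      refine ⟨insert_mem_pairings hu h.1 h.2, fun h' => ?_⟩
      exact h' _ (Finset.mem_insert_self _ _) (Sym2.mem_mk_left u x)
    · rintro ⟨x, M⟩ h ⟨x', M'⟩ h' heq
      simp only [Finset.mem_sigma] at h h'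
      dsimp only at heq
      have hM := fun e he => (mem_pairings_erase.1 (mem_pairings_erase.1 h.2).1).2 e he
      have hM' := fun e he => (mem_pairings_erase.1 (mem_pairings_erase.1 h'.2).1).2 e he
      have hn : s(u, x) ∉ M := fun hh => hM _ hh (Sym2.mem_mk_left u x)
      have hn' : s(u, x') ∉ M' := fun hh => hM' _ hh (Sym2.mem_mk_left u x')
      have hx : s(u, x) ∈ insert s(u, x') M' := heq ▸ Finset.mem_insert_self _ _
      rw [Finset.mem_insert] at hx
      rcases hx with hx | hx
      · have hxx : x = x' := Sym2.congr_right.1 hx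
        subst hxx
        have : M = M' := by
          rw [← Finset.erase_insert hn, heq, Finset.erase_insert hn']
        rw [this]
      · exact absurd (Sym2.mem_mk_left u x) (hM' _ hx)
    · intro M hM
      rw [Finset.mem_filter] at hM
      obtain ⟨hM, h⟩ := hM
      push Not at h
      obtain ⟨e, he, hue⟩ := h
      obtain ⟨x, rfl⟩ := hue
      have hxu : x ∈ S.erase u := by
        rw [Finset.mem_erase]
        rw [mem_pairings] at hM
        refine ⟨fun h => hM.2.1 _ he (by simp [h]), hM.1 _ he x (Sym2.mem_mk_right u x)⟩
      exact ⟨⟨x, M.erase s(u, x)⟩, Finset.mem_sigma.2 ⟨hxu, erase_mem_pairings hM he⟩,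
        Finset.insert_erase he⟩
    · intros
      rfl

theorem uncovered_of_erase {S : Finset V} {M : Finset (Sym2 V)} {u : V} (hu : u ∈ S)
    (hM : M ∈ pairings (S.erase u)) : uncovered S M = insert u (uncovered (S.erase u) M) := by
  have := notMem_of_mem_pairings_erase hM
  ext v
  simp only [mem_uncovered, Finset.mem_insert, Finset.mem_erase]
  grind

theorem uncovered_insert_edge {S : Finset V} {M : Finset (Sym2 V)} {u x : V} :
    uncovered S (insert s(u, x) M) = uncovered ((S.erase u).erase x) M := by
  ext v
  simp only [mem_uncovered, Finset.mem_insert, Finset.mem_erase, forall_eq_or_imp, Sym2.mem_iff]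
  grind

theorem notMem_uncovered_erase {S : Finset V} {M : Finset (Sym2 V)} {u : V} :
    u ∉ uncovered (S.erase u) M := by
  simp [mem_uncovered]

theorem edge_notMem_of_pairings {S : Finset V} {M : Finset (Sym2 V)} {u x : V}
    (hM : M ∈ pairings ((S.erase u).erase x)) : s(u, x) ∉ M := fun h =>
  (mem_pairings_erase.1 hM).2 _ h (Sym2.mem_mk_right u x)

theorem partitionFn_expand (w : Sym2 V → ℝ) (r : V → ℝ) {S : Finset V} {u : V} (hu : u ∈ S) :
    partitionFn w r S = r u * partitionFn w r (S.erase u) +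
      ∑ x ∈ S.erase u, w s(u, x) * partitionFn w r ((S.erase u).erase x) := by
  unfold partitionFn
  rw [sum_pairings _ hu, Finset.mul_sum]
  congr 1
  · refine Finset.sum_congr rfl fun M hM => ?_
    rw [uncovered_of_erase hu hM, Finset.prod_insert notMem_uncovered_erase]
    ring
  · refine Finset.sum_congr rfl fun x hx => ?_
    rw [Finset.mul_sum]
    refine Finset.sum_congr rfl fun M hM => ?_
    rw [uncovered_insert_edge, Finset.prod_insert (edge_notMem_of_pairings hM)]
    ring

theorem partitionFn_nonneg {w : Sym2 V → ℝ} {r : V → ℝ} (hw : ∀ e, 0 ≤ w e) (hr : ∀ v, 0 ≤ r v)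
    (S : Finset V) : 0 ≤ partitionFn w r S :=
  Finset.sum_nonneg fun _ _ => mul_nonneg (Finset.prod_nonneg fun _ _ => hw _)
    (Finset.prod_nonneg fun _ _ => hr _)

theorem partitionFn_congr {w w' : Sym2 V → ℝ} {r r' : V → ℝ} {S : Finset V}
    (hw : ∀ e, (∀ v ∈ e, v ∈ S) → w e = w' e) (hr : ∀ v ∈ S, r v = r' v) :
    partitionFn w r S = partitionFn w' r' S := by
  refine Finset.sum_congr rfl fun M hM => ?_
  rw [mem_pairings] at hM
  congr 1
  · exact Finset.prod_congr rfl fun e he => hw e (hM.1 e he)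
  · exact Finset.prod_congr rfl fun v hv => hr v (mem_uncovered.1 hv).1

theorem partitionFn_zero (r : V → ℝ) (S : Finset V) :
    partitionFn (fun _ => 0) r S = ∏ v ∈ S, r v := by
  unfold partitionFn
  rw [Finset.sum_eq_single ∅]
  · simp [uncovered]
  · intro M _ hne
    obtain ⟨e, he⟩ := Finset.nonempty_iff_ne_empty.2 hne
    rw [Finset.prod_eq_zero he rfl, zero_mul]
  · intro h
    exact absurd (mem_pairings.2 (by simp [IsPairing])) h

theorem partitionFn_empty (w : Sym2 V → ℝ) (r : V → ℝ) :
    partitionFn w r ∅ = 1 := by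
  rw [partitionFn_congr (w' := fun _ => 0) (r' := r) _ fun _ _ => rfl, partitionFn_zero]
  · simp
  · intro e he
    induction e with
    | h a b => exact absurd (he a (by simp)) (by simp)

/-- The partition function is affine in each monomer weight. -/
theorem partitionFn_add_single (w : Sym2 V → ℝ) (r : V → ℝ) {S : Finset V} {i : V} (hi : i ∈ S)
    (p : ℝ) : partitionFn w (r + Pi.single i p) S =
      partitionFn w r S + p * partitionFn w r (S.erase i) := by
  have h : ∀ T : Finset V, i ∉ T → partitionFn w (r + Pi.single i p) T = partitionFn w r T :=
    fun T hT => partitionFn_congr (fun _ _ => rfl) fun v hv => by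
      simp [show v ≠ i from fun h => hT (h ▸ hv)]
  rw [partitionFn_expand w _ hi, partitionFn_expand w r hi, h _ (by simp)]
  rw [Finset.sum_congr rfl fun x _ => by rw [h ((S.erase i).erase x) (by simp)]]
  simp only [Pi.add_apply, Pi.single_eq_same]
  ring

/-- The partition function is affine in each dimer weight. -/
theorem partitionFn_add_single_edge (w : Sym2 V → ℝ) (r : V → ℝ) {S : Finset V} {i j : V}
    (hi : i ∈ S) (hj : j ∈ S) (hij : i ≠ j) (p : ℝ) :
    partitionFn (w + Pi.single s(i, j) p) r S =
      partitionFn w r S + p * partitionFn w r ((S.erase i).erase j) := by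
  have h : ∀ T : Finset V, i ∉ T →
      partitionFn (w + Pi.single s(i, j) p) r T = partitionFn w r T :=
    fun T hT => partitionFn_congr (fun e he => by
      have : e ≠ s(i, j) := fun h => hT (he i (h ▸ Sym2.mem_mk_left i j))
      simp [this]) fun _ _ => rfl
  rw [partitionFn_expand _ r hi, partitionFn_expand w r hi, h _ (by simp)]
  rw [Finset.sum_congr rfl fun x _ => by rw [h ((S.erase i).erase x) (by simp)]]
  have hj' : j ∈ S.erase i := Finset.mem_erase.2 ⟨hij.symm, hj⟩
  simp only [Pi.add_apply, add_mul, Finset.sum_add_distrib]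
  rw [Finset.sum_eq_single (a := j) (f := fun x => (Pi.single s(i, j) p : Sym2 V → ℝ) s(i, x) *
    partitionFn w r ((S.erase i).erase x))]
  · simp only [Pi.single_eq_same]
    ring
  · intro x _ hx
    rw [Pi.single_eq_of_ne, zero_mul]
    exact fun h => hx (Sym2.congr_right.1 h)
  · exact fun h => absurd hj' h

/-- Coverings of two vertices are positively correlated if these lie on different sides of a
bipartite graph, and negatively correlated if they lie on the same side. -/
theorem partitionFn_correlation {w : Sym2 V → ℝ} {r : V → ℝ} (hw : ∀ e, 0 ≤ w e)
    (c : V → Bool) (hc : ∀ u v, c u = c v → w s(u, v) = 0) (S : Finset V) :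
    ∀ u ∈ S, ∀ v ∈ S, u ≠ v →
      (c u ≠ c v → partitionFn w r (S.erase u) * partitionFn w r (S.erase v) ≤
        partitionFn w r S * partitionFn w r ((S.erase u).erase v)) ∧
      (c u = c v → partitionFn w r S * partitionFn w r ((S.erase u).erase v) ≤
        partitionFn w r (S.erase u) * partitionFn w r (S.erase v)) := by
  induction S using Finset.strongInduction with
  | H S ih =>
    intro u hu v hv huv
    have hvu : v ∈ S.erase u := Finset.mem_erase.2 ⟨huv.symm, hv⟩
    have huv' : u ∈ S.erase v := Finset.mem_erase.2 ⟨huv, hu⟩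
    set Z := partitionFn w r with hZ
    -- Expand `Z S` and `Z (S.erase v)` at `u`. The monomer terms cancel, the partner `v` gives the
    -- square, and every other partner `x` gives the correlation of `x` and `v` in `S.erase u`,
    -- which is covered by induction.
    have key : Z S * Z ((S.erase u).erase v) - Z (S.erase u) * Z (S.erase v) =
        w s(u, v) * Z ((S.erase u).erase v) ^ 2 -
        ∑ x ∈ (S.erase u).erase v, w s(u, x) * (Z (S.erase u) * Z (((S.erase u).erase x).erase v) -
          Z ((S.erase u).erase x) * Z ((S.erase u).erase v)) := by
      rw [hZ, partitionFn_expand w r hu, partitionFn_expand w r huv', ← hZ,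
        ← Finset.add_sum_erase _ _ hvu, Finset.erase_right_comm (s := S) (a := v) (b := u)]
      simp only [mul_sub, Finset.sum_sub_distrib, add_mul, mul_add, Finset.mul_sum,
        Finset.sum_mul]
      have e1 : ∀ x, w s(u, x) * (Z (S.erase u) * Z (((S.erase u).erase x).erase v)) =
          Z (S.erase u) * (w s(u, x) * Z (((S.erase u).erase v).erase x)) := fun x => by
        rw [Finset.erase_right_comm (s := S.erase u) (a := x) (b := v)]
        ring
      have e2 : ∀ x, w s(u, x) * (Z ((S.erase u).erase x) * Z ((S.erase u).erase v)) =
          w s(u, x) * Z ((S.erase u).erase x) * Z ((S.erase u).erase v) := fun x => by ring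
      simp only [e1, e2]
      ring
    have ihx : ∀ x ∈ (S.erase u).erase v, _ := fun x hx =>
      ih (S.erase u) (Finset.erase_ssubset hu) x (Finset.mem_of_mem_erase hx) v hvu
        (Finset.ne_of_mem_erase hx)
    constructor
    · intro hcuv
      have hs : ∑ x ∈ (S.erase u).erase v, w s(u, x) *
          (Z (S.erase u) * Z (((S.erase u).erase x).erase v) -
          Z ((S.erase u).erase x) * Z ((S.erase u).erase v)) ≤ 0 := by
        refine Finset.sum_nonpos fun x hx => ?_
        by_cases hcx : c u = c x
        · rw [hc u x hcx, zero_mul]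
        · refine mul_nonpos_of_nonneg_of_nonpos (hw _) ?_
          -- With only two colours, a neighbour of `u` has the colour of `v`, so the inequality of
          -- the opposite type is used for `x` and `v`.
          have : c x = c v := by
            revert hcx hcuv
            cases c u <;> cases c x <;> cases c v <;> simp
          linarith [(ihx x hx).2 this]
      have := mul_nonneg (hw s(u, v)) (sq_nonneg (Z ((S.erase u).erase v)))
      linarith
    · intro hcuv
      have hs : 0 ≤ ∑ x ∈ (S.erase u).erase v, w s(u, x) *
          (Z (S.erase u) * Z (((S.erase u).erase x).erase v) -
          Z ((S.erase u).erase x) * Z ((S.erase u).erase v)) := by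
        refine Finset.sum_nonneg fun x hx => ?_
        by_cases hcx : c u = c x
        · rw [hc u x hcx, zero_mul]
        · refine mul_nonneg (hw _) ?_
          have : c x ≠ c v := fun h => hcx (hcuv.trans h.symm)
          linarith [(ihx x hx).1 this]
      rw [hc u v hcuv] at key
      linarith

end MonomerDimer

/-! ### A capacity inequality for bilinear polynomials. -/

section Capacity

/-- The condition on the coefficients lets `A + B Y + C T + D Y T` be dominated coefficientwise by
`A (1 + β Y) (1 + γ T)`, with equality in the constant and the top coefficient. The variables then
separate. -/
theorem exists_dominating_factors {A B C D : ℝ} (hA : 0 < A) (hB : 0 ≤ B) (hC : 0 ≤ C)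
    (hD : 0 < D) (h : B * C ≤ A * D) :
    ∃ β γ : ℝ, 0 < β ∧ 0 < γ ∧ B ≤ A * β ∧ C ≤ A * γ ∧ A * β * γ = D := by
  rcases hB.eq_or_lt with rfl | hB
  · refine ⟨D / (C + 1), (C + 1) / A, by positivity, by positivity, by positivity, ?_, ?_⟩
    · rw [mul_div_cancel₀ _ hA.ne']
      linarith
    · field_simp
  · refine ⟨B / A, D / B, by positivity, by positivity, ?_, ?_, ?_⟩
    · rw [mul_div_cancel₀ _ hA.ne']
    · rw [← mul_div_assoc, le_div_iff₀ hB]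
      linarith
    · field_simp

theorem capacity_le_of_pos {A B C D K α : ℝ} (hA : 0 < A) (hB : 0 ≤ B) (hC : 0 ≤ C) (hD : 0 < D)
    (hα : 0 < α) (hα' : α < 1) (h : B * C ≤ A * D)
    (hf : ∀ Y T : ℝ, 0 < Y → 0 < T → K * (Y ^ α * T ^ α) ≤ A + B * Y + C * T + D * (Y * T)) :
    (1 - α) ^ (1 - α) * K ≤ A + D / α := by
  obtain ⟨β, γ, hβ, hγ, hBβ, hCγ, hDβ⟩ := exists_dominating_factors hA hB hC hD h
  have hα1 : 0 < 1 - α := by linarith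
  -- The minimizers of `(1 + β Y) / Y ^ α` and `(1 + γ T) / T ^ α`; each linear factor takes the
  -- value `1 / (1 - α)` there.
  set Y := α / ((1 - α) * β) with hY
  set T := α / ((1 - α) * γ) with hT
  have hYp : 0 < Y := by positivity
  have hTp : 0 < T := by positivity
  have hYT : 0 < Y ^ α * T ^ α := by positivity
  have h1 : K * (Y ^ α * T ^ α) ≤ A / (1 - α) ^ 2 := by
    refine (hf Y T hYp hTp).trans ?_
    have e1 : B * Y ≤ A * β * Y := mul_le_mul_of_nonneg_right hBβ hYp.le
    have e2 : C * T ≤ A * γ * T := mul_le_mul_of_nonneg_right hCγ hTp.le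
    have e3 : A + A * β * Y + A * γ * T + D * (Y * T) = A / (1 - α) ^ 2 := by
      rw [← hDβ, hY, hT]
      field_simp
      ring
    linarith
  -- Up to `(1 - α) ^ (1 - α)`, the capacity of the dominating product is the geometric mean of `A /
  -- (1 - α)` and `D / α ^ 2` with weights `1 - α` and `α`. The corresponding arithmetic mean is `A
  -- + D / α`.
  have h2 : (A / (1 - α)) ^ (1 - α) * (D / α ^ 2) ^ α * (Y ^ α * T ^ α) =
      (1 - α) ^ (1 - α) * (A / (1 - α) ^ 2) := by
    have p1 : 0 < A / (1 - α) := by positivity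
    have p2 : 0 < D / α ^ 2 := by positivity
    refine Real.log_injOn_pos (Set.mem_Ioi.2 (by positivity)) (Set.mem_Ioi.2 (by positivity)) ?_
    rw [Real.log_mul (by positivity) (by positivity), Real.log_mul (by positivity) (by positivity),
      Real.log_mul (by positivity) (by positivity), Real.log_mul (by positivity) (by positivity),
      Real.log_rpow p1, Real.log_rpow p2, Real.log_rpow hYp, Real.log_rpow hTp, Real.log_rpow hα1,
      hY, hT, Real.log_div hA.ne' hα1.ne', Real.log_div hD.ne' (by positivity),
      Real.log_div hα.ne' (by positivity), Real.log_div hα.ne' (by positivity),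
      Real.log_div hA.ne' (by positivity), Real.log_mul hα1.ne' hβ.ne',
      Real.log_mul hα1.ne' hγ.ne', Real.log_pow, Real.log_pow, ← hDβ,
      Real.log_mul (by positivity) hγ.ne', Real.log_mul hA.ne' hβ.ne']
    push_cast
    ring
  have h3 : (1 - α) ^ (1 - α) * K ≤ (A / (1 - α)) ^ (1 - α) * (D / α ^ 2) ^ α := by
    refine le_of_mul_le_mul_right ?_ hYT
    rw [h2, mul_assoc]
    exact mul_le_mul_of_nonneg_left h1 (by positivity)
  have h4 := Real.geom_mean_le_arith_mean2_weighted hα1.le hα.le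
    (show 0 ≤ A / (1 - α) by positivity) (show 0 ≤ D / α ^ 2 by positivity) (by ring)
  refine h3.trans (h4.trans_eq ?_)
  field_simp

/-- The bilinear case of the capacity bound for bistable polynomials. -/
theorem capacity_le {A B C D K α : ℝ} (hA : 0 ≤ A) (hB : 0 ≤ B) (hC : 0 ≤ C) (hD : 0 ≤ D)
    (hα : 0 < α) (hα' : α ≤ 1) (h : B * C ≤ A * D)
    (hf : ∀ Y T : ℝ, 0 < Y → 0 < T → K * (Y ^ α * T ^ α) ≤ A + B * Y + C * T + D * (Y * T)) :
    (1 - α) ^ (1 - α) * K ≤ A + D / α := by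
  rcases hα'.eq_or_lt with rfl | hα'
  -- For `α = 1` the claim follows from `K ≤ D`, seen by letting `Y = T` be large.
  · simp only [sub_self, Real.rpow_zero, one_mul, div_one]
    by_contra! hK
    have hKD : 0 < K - D := by linarith
    set t := 1 + (A + B + C) / (K - D) with ht
    have ht1 : 1 ≤ t := by
      have : 0 ≤ (A + B + C) / (K - D) := by positivity
      linarith
    have h1 := hf t t (by linarith) (by linarith)
    rw [Real.rpow_one] at h1
    have h2 : (K - D) * t = (K - D) + (A + B + C) := by
      rw [ht]
      field_simp
    have h3 : A ≤ A * t := le_mul_of_one_le_right hA ht1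
    have h4 : ((K - D) * t) * t ≤ (A + B + C) * t := by nlinarith
    have h5 := le_of_mul_le_mul_right h4 (by linarith)
    linarith
  · refine le_of_forall_pos_le_add fun ε hε => ?_
    -- Adding `η` to both `A` and `D` makes them positive and raises `A + D / α` by exactly `ε`.
    set η := ε / (1 + 1 / α) with hη
    have hηp : 0 < η := by positivity
    have := capacity_le_of_pos (A := A + η) (D := D + η) (B := B) (C := C) (K := K) (α := α)
      (by linarith) hB hC (by linarith) hα hα'
      (by nlinarith [mul_nonneg hA hηp.le, mul_nonneg hD hηp.le]) fun Y T hY hT => by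
        have := hf Y T hY hT
        have := mul_pos hηp (mul_pos hY hT)
        linarith
    refine this.trans_eq ?_
    rw [hη]
    field_simp
    ring

end Capacity

/-! ### The Bethe lower bound by gluing half-edges. -/

section Bethe

variable {V : Type*} [DecidableEq V] [Fintype V]

/-- Edges outside `E` are cut: the half-edge at `u` towards `v` adds `a s(u, v) * y u v` to the
monomer weight of `u`. Adding an edge to `E` glues its halves, by `capacity_le`. The variables `y`
stay universally quantified because gluing uses the previous bound for all values at the two ends.
-/
theorem le_partitionFn_of_partial {a : Sym2 V → ℝ} {s : V → ℝ} (ha : ∀ e, 0 ≤ a e)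
    (hs : ∀ v, 0 ≤ s v) (c : V → Bool) (hc : ∀ u v, c u = c v → a s(u, v) = 0)
    (hsum : ∀ u, s u + ∑ v, a s(u, v) = 1) (E : Finset (Sym2 V)) :
    ∀ y : V → V → ℝ, (∀ u v, 0 < y u v) →
      (∏ e ∈ E, (1 - a e) ^ (1 - a e)) *
        ∏ u, ∏ v, (if s(u, v) ∈ E then 1 else y u v ^ a s(u, v)) ≤
      partitionFn (fun e => if e ∈ E then a e else 0)
        (fun u => s u + ∑ v, if s(u, v) ∈ E then 0 else a s(u, v) * y u v) Finset.univ := by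
  induction E using Finset.induction_on with
  | empty =>
    intro y hy
    -- With all edges cut, the bound is weighted AM-GM at each vertex; `none` stands for the genuine
    -- monomer.
    simp only [Finset.notMem_empty, if_false, Finset.prod_empty, one_mul]
    rw [partitionFn_zero]
    refine Finset.prod_le_prod (fun u _ => Finset.prod_nonneg fun v _ =>
      Real.rpow_nonneg (hy u v).le _) fun u _ => ?_
    have := Real.geom_mean_le_arith_mean_weighted (Finset.univ : Finset (Option V))
      (fun o => o.elim (s u) fun v => a s(u, v)) (fun o => o.elim 1 fun v => y u v)
      (fun o _ => by cases o <;> simp [hs, ha]) (by simp [Fintype.sum_option, hsum])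
      (fun o _ => by cases o <;> simp [(hy _ _).le])
    simpa [Fintype.sum_option, Fintype.prod_option] using this
  | insert e E heE ih =>
    intro y hy
    induction e with
    | h i j =>
    rcases (ha s(i, j)).eq_or_lt with h0 | h0
    · have hm : ∀ e, a e ≠ 0 → (e ∈ insert s(i, j) E ↔ e ∈ E) := fun e he => by
        rw [Finset.mem_insert, or_iff_right]
        rintro rfl
        exact he h0.symm
      refine le_of_eq_of_le ?_ ((ih y hy).trans_eq ?_)
      · rw [Finset.prod_insert heE, ← h0]
        simp only [sub_zero, Real.rpow_one, one_mul]
        congr 1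
        refine Finset.prod_congr rfl fun u _ => Finset.prod_congr rfl fun v _ => ?_
        by_cases h : a s(u, v) = 0
        · simp [h]
        · simp only [hm _ h]
      · congr 1
        · funext e
          by_cases h : a e = 0
          · simp [h]
          · simp only [hm _ h]
        · funext u
          congr 1
          refine Finset.sum_congr rfl fun v _ => ?_
          by_cases h : a s(u, v) = 0
          · simp [h]
          · simp only [hm _ h]
    · have hcij : c i ≠ c j := fun h => h0.ne' (hc i j h)
      have hij : i ≠ j := fun h => hcij (h ▸ rfl)
      have hle : a s(i, j) ≤ 1 := by
        have h1 : a s(i, j) ≤ ∑ v, a s(i, v) :=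
          Finset.single_le_sum (f := fun v => a s(i, v)) (fun v _ => ha _) (Finset.mem_univ j)
        linarith [hs i, hsum i]
      set α := a s(i, j) with hα
      set w : Sym2 V → ℝ := fun e => if e ∈ E then a e else 0 with hw
      set r : V → ℝ := fun u => s u + ∑ v, if s(u, v) ∈ insert s(i, j) E then 0
        else a s(u, v) * y u v with hr
      have hw0 : ∀ e, 0 ≤ w e := fun e => by
        simp only [hw]
        split_ifs
        exacts [ha e, le_rfl]
      have hr0 : ∀ u, 0 ≤ r u := fun u => by
        refine add_nonneg (hs u) (Finset.sum_nonneg fun v _ => ?_)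
        split_ifs
        exacts [le_rfl, mul_nonneg (ha _) (hy u v).le]
      have hwE : (fun e => if e ∈ insert s(i, j) E then a e else 0) =
          w + Pi.single s(i, j) α := by
        funext e
        by_cases he : e = s(i, j)
        · subst he
          simp [hw, heE, hα]
        · simp [hw, he]
      rw [hwE, partitionFn_add_single_edge w r (Finset.mem_univ i) (Finset.mem_univ j) hij,
        Finset.prod_insert heE, mul_assoc]
      set Z := partitionFn w r with hZ
      have hZ0 : ∀ S, 0 ≤ Z S := partitionFn_nonneg hw0 hr0
      -- In the two half-edge variables the top coefficient is `D = α ^ 2 * Z (..)`, whereas the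
      -- glued edge contributes `α * Z (..) = D / α`.
      have e1 : α * Z ((Finset.univ.erase i).erase j) =
          α ^ 2 * Z ((Finset.univ.erase i).erase j) / α := by
        field_simp
      rw [e1]
      have hcor := (partitionFn_correlation (r := r) hw0 c (fun u v h => by
        simp [hw, hc u v h]) Finset.univ i (Finset.mem_univ i) j (Finset.mem_univ j) hij).1 hcij
      rw [← hZ] at hcor
      refine capacity_le (B := α * Z (Finset.univ.erase i)) (C := α * Z (Finset.univ.erase j))
        (hZ0 _) (mul_nonneg h0.le (hZ0 _)) (mul_nonneg h0.le (hZ0 _))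
        (mul_nonneg (sq_nonneg _) (hZ0 _)) h0 hle ?_ fun Y T hY hT => ?_
      · have := mul_le_mul_of_nonneg_left hcor (sq_nonneg α)
        linarith
      set y' : V → V → ℝ := fun u v => if u = i ∧ v = j then Y else if u = j ∧ v = i then T
        else y u v with hy'
      have hpair : ∀ u v, s(u, v) = s(i, j) ↔ (u = i ∧ v = j) ∨ (u = j ∧ v = i) := fun u v =>
        Sym2.eq_iff
      have hih := ih y' fun u v => by
        simp only [hy']
        split_ifs
        exacts [hY, hT, hy u v]
      have hprod : (∏ u, ∏ v, (if s(u, v) ∈ E then 1 else y' u v ^ a s(u, v))) =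
          (∏ u, ∏ v, (if s(u, v) ∈ insert s(i, j) E then 1 else y u v ^ a s(u, v))) *
            (Y ^ α * T ^ α) := by
        have ht : ∀ u v, (if s(u, v) ∈ E then 1 else y' u v ^ a s(u, v)) =
            (if s(u, v) ∈ insert s(i, j) E then 1 else y u v ^ a s(u, v)) *
            ((if u = i then if v = j then Y ^ α else 1 else 1) *
              (if u = j then if v = i then T ^ α else 1 else 1)) := by
          intro u v
          by_cases h1 : u = i ∧ v = j
          · obtain ⟨rfl, rfl⟩ := h1
            simp [heE, hy', hij, hα]
          · by_cases h2 : u = j ∧ v = i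
            · obtain ⟨rfl, rfl⟩ := h2
              have heE' : s(u, v) ∉ E := by rwa [Sym2.eq_swap]
              simp [heE', hy', hij.symm, hα, Sym2.eq_swap]
            · have h3 : s(u, v) ≠ s(i, j) := fun h => ((hpair u v).1 h).elim h1 h2
              have h4 : y' u v = y u v := by simp [hy', h1, h2]
              rw [h4, ← ite_and, ← ite_and, if_neg h1, if_neg h2]
              simp [h3]
        simp only [ht, Finset.prod_mul_distrib]
        congr 2
        · simp
        · simp
      have hρ : (fun u => s u + ∑ v, if s(u, v) ∈ E then 0 else a s(u, v) * y' u v) =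
          r + Pi.single i (α * Y) + Pi.single j (α * T) := by
        have ht : ∀ u v, (if s(u, v) ∈ E then 0 else a s(u, v) * y' u v) =
            (if s(u, v) ∈ insert s(i, j) E then 0 else a s(u, v) * y u v) +
            ((if u = i then if v = j then α * Y else 0 else 0) +
              (if u = j then if v = i then α * T else 0 else 0)) := by
          intro u v
          by_cases h1 : u = i ∧ v = j
          · obtain ⟨rfl, rfl⟩ := h1
            simp [heE, hy', hij, hα]
          · by_cases h2 : u = j ∧ v = i
            · obtain ⟨rfl, rfl⟩ := h2
              have heE' : s(u, v) ∉ E := by rwa [Sym2.eq_swap]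
              simp [heE', hy', hij.symm, hα, Sym2.eq_swap]
            · have h3 : s(u, v) ≠ s(i, j) := fun h => ((hpair u v).1 h).elim h1 h2
              have h4 : y' u v = y u v := by simp [hy', h1, h2]
              rw [h4, ← ite_and, ← ite_and, if_neg h1, if_neg h2]
              simp [h3]
        funext u
        simp only [ht, Finset.sum_add_distrib, Pi.add_apply, hr, Pi.single_apply]
        have q1 : (∑ v, if u = i then if v = j then α * Y else 0 else 0) =
            if u = i then α * Y else 0 := by
          split_ifs <;> simp
        have q2 : (∑ v, if u = j then if v = i then α * T else 0 else 0) =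
            if u = j then α * T else 0 := by
          split_ifs <;> simp
        rw [q1, q2]
        ring
      rw [hprod, hρ, partitionFn_add_single _ _ (Finset.mem_univ j),
        partitionFn_add_single _ _ (Finset.mem_univ i),
        partitionFn_add_single _ _ (Finset.mem_erase.2 ⟨hij, Finset.mem_univ i⟩), ← hZ,
        Finset.erase_right_comm (a := j) (b := i)] at hih
      rw [← mul_assoc] at hih
      refine hih.trans_eq ?_
      ring

/-- **The Bethe lower bound** for the monomer-dimer partition function of a bipartite graph. -/
theorem prod_le_partitionFn {a : Sym2 V → ℝ} {s : V → ℝ} (ha : ∀ e, 0 ≤ a e)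
    (hs : ∀ v, 0 ≤ s v) (c : V → Bool) (hc : ∀ u v, c u = c v → a s(u, v) = 0)
    (hsum : ∀ u, s u + ∑ v, a s(u, v) = 1) :
    ∏ e, (1 - a e) ^ (1 - a e) ≤ partitionFn a s Finset.univ := by
  simpa using le_partitionFn_of_partial ha hs c hc hsum Finset.univ (fun _ _ => 1)
    fun _ _ => one_pos

end Bethe

/-! ### Matchings of a fixed size through auxiliary vertices. -/

section AttachWeight

variable {V : Type*}

/-- Dimer weights of a graph to whose vertices of colour `true` further vertices are attached. -/
noncomputable def attachWeight (x : Sym2 V → ℝ) (h : V → ℝ) (D : Type*) : Sym2 (V ⊕ D) → ℝ :=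
  Sym2.lift ⟨fun p q => match p, q with
    | Sum.inl u, Sum.inl v => x s(u, v)
    | Sum.inl u, Sum.inr _ => h u
    | Sum.inr _, Sum.inl v => h v
    | Sum.inr _, Sum.inr _ => 0, by
      rintro (u | u) (v | v) <;> simp [Sym2.eq_swap]⟩

variable (x : Sym2 V → ℝ) (h : V → ℝ) {D : Type*}

@[simp] theorem attachWeight_inl_inl (u v : V) :
    attachWeight x h D s(Sum.inl u, Sum.inl v) = x s(u, v) := rfl

@[simp] theorem attachWeight_inl_inr (u : V) (v : D) :
    attachWeight x h D s(Sum.inl u, Sum.inr v) = h u := rfl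

@[simp] theorem attachWeight_inr_inl (u : D) (v : V) :
    attachWeight x h D s(Sum.inr u, Sum.inl v) = h v := rfl

@[simp] theorem attachWeight_inr_inr (u v : D) :
    attachWeight x h D s(Sum.inr u, Sum.inr v) = 0 := rfl

end AttachWeight

section FixedSize

variable {V V' : Type*} [DecidableEq V] [DecidableEq V']

theorem partitionFn_map (f : V ↪ V') (w : Sym2 V' → ℝ) (r : V' → ℝ) (S : Finset V) :
    partitionFn w r (S.map f) = partitionFn (fun e => w (e.map f)) (fun v => r (f v)) S := by
  induction S using Finset.strongInduction with
  | H S ih =>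
    rcases S.eq_empty_or_nonempty with rfl | ⟨u, hu⟩
    · simp [partitionFn_empty]
    · rw [partitionFn_expand _ _ hu, partitionFn_expand _ _ (Finset.mem_map_of_mem f hu),
        ← Finset.map_erase, ih _ (Finset.erase_ssubset hu), Finset.sum_map]
      congr 1
      refine Finset.sum_congr rfl fun x hx => ?_
      rw [← Finset.map_erase, ih _ ((Finset.erase_ssubset hx).trans (Finset.erase_ssubset hu))]
      rfl

/-- The contribution to the partition function of the matchings that leave exactly `m` vertices of
colour `true` uncovered. -/
noncomputable def partitionFnDefect (x : Sym2 V → ℝ) (g : V → ℝ) (c : V → Bool) (m : ℕ)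
    (S : Finset V) : ℝ :=
  ∑ M ∈ pairings S with ((uncovered S M).filter fun v => c v = true).card = m,
    (∏ e ∈ M, x e) * ∏ v ∈ uncovered S M, g v

theorem partitionFnDefect_zero (x : Sym2 V → ℝ) (g : V → ℝ) (c : V → Bool) (S : Finset V) :
    partitionFnDefect x g c 0 S = partitionFn x (fun v => if c v = true then 0 else g v) S := by
  unfold partitionFnDefect partitionFn
  rw [Finset.sum_filter]
  refine Finset.sum_congr rfl fun M _ => ?_
  split_ifs with h
  · congr 1
    refine Finset.prod_congr rfl fun v hv => ?_
    rw [Finset.card_eq_zero, Finset.filter_eq_empty_iff] at h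
    exact (if_neg (h hv)).symm
  · obtain ⟨v, hv⟩ := Finset.card_pos.1 (Nat.pos_of_ne_zero h)
    rw [Finset.mem_filter] at hv
    have h0 : ∏ v ∈ uncovered S M, (if c v = true then 0 else g v) = 0 :=
      Finset.prod_eq_zero hv.1 (if_pos hv.2)
    rw [h0, mul_zero]

/-- Double counting: mark one of the `m + 1` uncovered vertices of colour `true` and delete it. -/
theorem sum_partitionFnDefect_erase (x : Sym2 V → ℝ) (g : V → ℝ) (c : V → Bool) (m : ℕ)
    (S : Finset V) :
    ∑ i ∈ S with c i = true, g i * partitionFnDefect x g c m (S.erase i) =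
      (m + 1) * partitionFnDefect x g c (m + 1) S := by
  have h1 : ∀ i ∈ S.filter (fun i => c i = true), g i * partitionFnDefect x g c m (S.erase i) =
      ∑ M ∈ pairings S with ((uncovered S M).filter fun v => c v = true).card = m + 1,
        if i ∈ uncovered S M then (∏ e ∈ M, x e) * ∏ v ∈ uncovered S M, g v else 0 := by
    intro i hi
    rw [Finset.mem_filter] at hi
    rw [← Finset.sum_filter, Finset.filter_filter, partitionFnDefect, Finset.mul_sum]
    have hset : (pairings (S.erase i)).filter
          (fun M => ((uncovered (S.erase i) M).filter fun v => c v = true).card = m) =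
        (pairings S).filter (fun M => ((uncovered S M).filter fun v => c v = true).card = m + 1 ∧
          i ∈ uncovered S M) := by
      ext M
      simp only [Finset.mem_filter]
      have hmem : M ∈ pairings (S.erase i) ↔ M ∈ pairings S ∧ i ∈ uncovered S M := by
        rw [mem_pairings_erase, mem_uncovered]
        simp [hi.1]
      have hcard : M ∈ pairings (S.erase i) →
          ((uncovered S M).filter fun v => c v = true).card =
            ((uncovered (S.erase i) M).filter fun v => c v = true).card + 1 := fun hM => by
        rw [uncovered_of_erase hi.1 hM, Finset.filter_insert, if_pos hi.2,
          Finset.card_insert_of_notMem]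
        exact fun h => notMem_uncovered_erase (Finset.mem_filter.1 h).1
      constructor
      · rintro ⟨h, h'⟩
        refine ⟨(hmem.1 h).1, ?_, (hmem.1 h).2⟩
        rw [hcard h, h']
      · rintro ⟨h, h', h''⟩
        have := hmem.2 ⟨h, h''⟩
        have := hcard this
        exact ⟨hmem.2 ⟨h, h''⟩, by omega⟩
    rw [← hset]
    refine Finset.sum_congr rfl fun M hM => ?_
    rw [Finset.mem_filter] at hM
    rw [uncovered_of_erase hi.1 hM.1, Finset.prod_insert notMem_uncovered_erase]
    ring
  rw [Finset.sum_congr rfl h1, Finset.sum_comm, partitionFnDefect, Finset.mul_sum]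
  refine Finset.sum_congr rfl fun M hM => ?_
  rw [Finset.mem_filter] at hM
  rw [← Finset.sum_filter, Finset.sum_const, nsmul_eq_mul, Finset.filter_filter]
  have : (S.filter fun i => c i = true ∧ i ∈ uncovered S M) =
      (uncovered S M).filter fun v => c v = true := by
    ext v
    simp only [Finset.mem_filter, mem_uncovered]
    tauto
  rw [this, hM.2]
  push_cast
  rfl

/-- Neither the vertices of `B` nor those of colour `true` may be monomers. So the uncovered `true`
vertices of a matching of `S` must be matched bijectively with `B`, in `B.card.factorial` ways of
equal weight. -/
theorem partitionFn_attach (x : Sym2 V → ℝ) (g : V → ℝ) (c : V → Bool) (t : ℝ) {D : Type*}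
    [DecidableEq D] (B : Finset D) : ∀ S : Finset V,
    partitionFn (attachWeight x (fun u => if c u = true then g u * t else 0) D)
      (Sum.elim (fun v => if c v = true then 0 else g v) fun _ => 0) (S.disjSum B) =
    B.card.factorial * t ^ B.card * partitionFnDefect x g c B.card S := by
  induction B using Finset.induction_on with
  | empty =>
    intro S
    rw [Finset.card_empty, partitionFnDefect_zero, Finset.disjSum_empty, partitionFn_map]
    simp only [Nat.factorial_zero, Nat.cast_one, pow_zero, one_mul]
    congr 1
    funext e
    induction e with
    | h u v => rfl
  | insert d B hd ih =>
    intro S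
    have hmem : (Sum.inr d : V ⊕ D) ∈ S.disjSum (insert d B) := by simp
    have herase : (S.disjSum (insert d B)).erase (Sum.inr d) = S.disjSum B := by
      ext (v | v)
      · simp
      · simp only [Finset.mem_erase, Finset.inr_mem_disjSum, Finset.mem_insert, ne_eq,
          Sum.inr.injEq]
        constructor
        · tauto
        · exact fun h => ⟨fun h' => hd (h' ▸ h), Or.inr h⟩
    have herase' : ∀ u, (S.disjSum B).erase (Sum.inl u) = (S.erase u).disjSum B := by
      intro u
      ext (v | v) <;> simp
    rw [partitionFn_expand _ _ hmem, herase, Finset.sum_disjSum]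
    simp only [Sum.elim_inr, zero_mul, attachWeight_inr_inl, attachWeight_inr_inr,
      Finset.sum_const_zero, add_zero, zero_add, herase', ih, Finset.card_insert_of_notMem hd]
    have := sum_partitionFnDefect_erase x g c B.card S
    rw [Nat.factorial_succ, pow_succ]
    push_cast
    calc _ = ∑ i ∈ S, if c i = true then B.card.factorial * t ^ B.card * t *
          (g i * partitionFnDefect x g c B.card (S.erase i)) else 0 := by
          refine Finset.sum_congr rfl fun i _ => ?_
          split_ifs <;> ring
      _ = B.card.factorial * t ^ B.card * t *
          ((B.card + 1) * partitionFnDefect x g c (B.card + 1) S) := by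
          rw [← Finset.sum_filter, ← Finset.mul_sum, this]
      _ = _ := by ring

/-- With this estimate the cost of a family of edges depends only on their total weight. -/
theorem exp_neg_le_one_sub_rpow {x : ℝ} (hx : x ≤ 1) : Real.exp (-x) ≤ (1 - x) ^ (1 - x) := by
  rcases hx.eq_or_lt with rfl | hx
  · simp
  · have h : 0 < 1 - x := by linarith
    rw [Real.rpow_def_of_pos h, Real.exp_le_exp]
    have h1 := Real.one_sub_inv_le_log_of_pos h
    have h2 := mul_le_mul_of_nonneg_right h1 h.le
    rw [sub_mul, inv_mul_cancel₀ h.ne'] at h2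
    linarith

variable [Fintype V]

theorem prod_attachWeight_ge {x : Sym2 V → ℝ} {h : V → ℝ} {D : Type*} [DecidableEq D] [Fintype D]
    (hx : ∀ e, x e ≤ 1) (hh : ∀ u, h u ≤ 1) :
    (∏ e, (1 - x e) ^ (1 - x e)) * Real.exp (-(Fintype.card D * ∑ u, h u)) ≤
      ∏ e, (1 - attachWeight x h D e) ^ (1 - attachWeight x h D e) := by
  set F : Sym2 (V ⊕ D) → ℝ := fun e =>
    (1 - attachWeight x h D e) ^ (1 - attachWeight x h D e) with hF
  have hinj : Function.Injective (Sym2.map (Sum.inl : V → V ⊕ D)) :=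
    Sym2.map.injective Sum.inl_injective
  have hinj' : Function.Injective (fun p : V × D => s((Sum.inl p.1 : V ⊕ D), Sum.inr p.2)) := by
    rintro ⟨u, d⟩ ⟨u', d'⟩ h
    simpa using h
  set A : Finset (Sym2 (V ⊕ D)) := Finset.univ.image (Sym2.map (Sum.inl : V → V ⊕ D)) with hA
  set B : Finset (Sym2 (V ⊕ D)) :=
    Finset.univ.image (fun p : V × D => s((Sum.inl p.1 : V ⊕ D), Sum.inr p.2)) with hB
  have hdisj : Disjoint A B := by
    rw [Finset.disjoint_left]
    intro e he he'
    simp only [hA, hB, Finset.mem_image, Finset.mem_univ, true_and] at he he'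
    obtain ⟨e, rfl⟩ := he
    obtain ⟨p, hp⟩ := he'
    induction e with
    | h u v => simp at hp
  have huniv : ∏ e, F e = ∏ e ∈ A ∪ B, F e := by
    symm
    refine Finset.prod_subset (Finset.subset_univ _) fun e _ he => ?_
    simp only [Finset.mem_union, not_or, hA, hB, Finset.mem_image, Finset.mem_univ, true_and,
      not_exists] at he
    induction e with
    | h p q =>
      rcases p with u | u <;> rcases q with v | v
      · exact absurd rfl (he.1 s(u, v))
      · exact absurd rfl (he.2 (u, v))
      · exact absurd Sym2.eq_swap (he.2 (v, u))
      · simp [hF]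
  rw [huniv, Finset.prod_union hdisj, hA, Finset.prod_image fun _ _ _ _ h => hinj h, hB,
    Finset.prod_image fun _ _ _ _ h => hinj' h]
  have h1 : ∀ e : Sym2 V, F (e.map Sum.inl) = (1 - x e) ^ (1 - x e) := by
    intro e
    induction e with
    | h u v => rfl
  simp only [h1]
  refine mul_le_mul_of_nonneg_left ?_ (Finset.prod_nonneg fun e _ =>
    Real.rpow_nonneg (by linarith [hx e]) _)
  have h2 : -(Fintype.card D * ∑ u, h u) = ∑ p : V × D, -h p.1 := by
    rw [Fintype.sum_prod_type]
    simp [Finset.mul_sum]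
  rw [h2, Real.exp_sum]
  exact Finset.prod_le_prod (fun _ _ => (Real.exp_pos _).le) fun p _ =>
    exp_neg_le_one_sub_rpow (hh p.1)

/-- The Bethe lower bound for the matchings of a fixed size. -/
theorem prod_le_partitionFnDefect {x : Sym2 V → ℝ} {g : V → ℝ} (hx : ∀ e, 0 ≤ x e)
    (hg : ∀ v, 0 ≤ g v) (c : V → Bool) (hc : ∀ u v, c u = c v → x s(u, v) = 0)
    (hsum : ∀ u, g u + ∑ v, x s(u, v) = 1) (a : ℕ) (ha : ∑ u with c u = true, g u = a) :
    (∏ e, (1 - x e) ^ (1 - x e)) * Real.exp (-a) * (a : ℝ) ^ a ≤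
      a.factorial * partitionFnDefect x g c a Finset.univ := by
  have hx1 : ∀ e, x e ≤ 1 := fun e => by
    induction e with
    | h u v =>
      have h1 := Finset.single_le_sum (f := fun v => x s(u, v)) (fun v _ => hx _)
        (Finset.mem_univ v)
      have := hsum u
      have := hg u
      linarith
  -- The monomer weight of each `true` vertex is spread evenly over `a` new vertices. All row sums
  -- are then 1, at the new vertices because the monomer weights sum to `a`.
  set h : V → ℝ := fun u => if c u = true then g u * (a : ℝ)⁻¹ else 0 with hh
  have hh0 : ∀ u, 0 ≤ h u := fun u => by
    simp only [hh]
    split_ifs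
    exacts [mul_nonneg (hg u) (by positivity), le_rfl]
  have hga : ∀ u, c u = true → g u * (a : ℝ)⁻¹ * a = g u := fun u hu => by
    -- For `a = 0` the inverse is 0, but then `g` vanishes on the colour `true` as well.
    rcases eq_or_ne (a : ℝ) 0 with h0 | h0
    · rw [h0, Finset.sum_eq_zero_iff_of_nonneg fun u _ => hg u] at ha
      rw [ha u (by simp [hu])]
      simp
    · field_simp
  have hhsum : (a : ℝ) * ∑ u, h u = a := by
    rw [hh, ← Finset.sum_filter, ← Finset.sum_mul, ha]
    rcases eq_or_ne (a : ℝ) 0 with h0 | h0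
    · simp [h0]
    · field_simp
  have hh1 : ∀ u, h u ≤ 1 := fun u => by
    rcases eq_or_ne (a : ℝ) 0 with h0 | h0
    · simp [hh, h0]
    · have h1 := Finset.single_le_sum (f := h) (fun v _ => hh0 v) (Finset.mem_univ u)
      have h2 : ∑ u, h u = 1 := mul_left_cancel₀ h0 (by rw [hhsum, mul_one])
      linarith
  have h1 := prod_attachWeight_ge (D := Fin a) hx1 hh1
  rw [Fintype.card_fin, hhsum] at h1
  have h2 := prod_le_partitionFn (a := attachWeight x h (Fin a))
    (s := Sum.elim (fun v => if c v = true then 0 else g v) fun _ => 0)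
    (fun e => by
      induction e with
      | h p q => rcases p with u | u <;> rcases q with v | v <;> simp [hx, hh0])
    (fun p => by
      rcases p with u | u
      · simp only [Sum.elim_inl]
        split_ifs
        exacts [le_rfl, hg u]
      · simp)
    -- New vertices are joined only to `true` vertices, so the colour `false` keeps the graph
    -- bipartite.
    (Sum.elim c fun _ => false)
    (fun p q => by
      rcases p with u | u <;> rcases q with v | v <;> simp +contextual [hh]
      exact hc u v)
    (fun p => by
      rcases p with u | u
      · simp only [Fintype.sum_sum_type, Sum.elim_inl, attachWeight_inl_inl, attachWeight_inl_inr,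
          Finset.sum_const, Finset.card_univ, Fintype.card_fin, nsmul_eq_mul]
        rw [← hsum u]
        by_cases hu : c u = true
        · simp only [hh, hu, if_true]
          linarith [hga u hu]
        · simp [hh, hu]
      · simp only [Fintype.sum_sum_type, Sum.elim_inr, attachWeight_inr_inl, attachWeight_inr_inr,
          Finset.sum_const_zero, add_zero, zero_add]
        have h0 : (a : ℝ) ≠ 0 := by
          have := u.pos
          positivity
        exact mul_left_cancel₀ h0 (by rw [hhsum, mul_one]))
  have h3 := partitionFn_attach x g c (a : ℝ)⁻¹ (Finset.univ : Finset (Fin a)) Finset.univ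
  rw [Finset.univ_disjSum_univ, Finset.card_univ, Fintype.card_fin] at h3
  have h4 := mul_le_mul_of_nonneg_right ((h1.trans h2).trans_eq h3)
    (show 0 ≤ (a : ℝ) ^ a by positivity)
  refine h4.trans_eq ?_
  rcases eq_or_ne (a : ℝ) 0 with h0 | h0
  · have : a = 0 := by exact_mod_cast h0
    subst this
    simp
  · rw [inv_pow]
    field_simp

end FixedSize

/-- The Stirling sequence decreases from `exp 1 / √2`. A loss polynomial in `a` disappears once
logarithms are divided by the volume. -/
theorem factorial_le_stirling {a : ℕ} (ha : a ≠ 0) :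
    (a.factorial : ℝ) ≤ Real.exp 1 * a * (Real.exp (-a) * (a : ℝ) ^ a) := by
  obtain ⟨n, rfl⟩ := Nat.exists_eq_succ_of_ne_zero ha
  have h := Stirling.stirlingSeq'_antitone (Nat.zero_le n)
  simp only [Function.comp_apply, Nat.succ_eq_add_one, zero_add, Stirling.stirlingSeq_one] at h
  unfold Stirling.stirlingSeq at h
  set b : ℝ := ((n + 1 : ℕ) : ℝ) with hb
  have hb1 : 1 ≤ b := by
    rw [hb]
    push_cast
    linarith [(Nat.cast_nonneg n : (0 : ℝ) ≤ n)]
  have hb0 : 0 < b := by linarith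
  rw [div_le_iff₀ (by positivity)] at h
  refine h.trans ?_
  have hs : √(2 * b) = √2 * √b := Real.sqrt_mul (by norm_num) b
  have hsb : √b ≤ b := Real.sqrt_le_iff.2 ⟨hb0.le, by nlinarith⟩
  have he : (b / Real.exp 1) ^ (n + 1) = Real.exp (-b) * b ^ (n + 1) := by
    rw [div_pow, ← Real.exp_nat_mul, mul_one, Real.exp_neg, div_eq_mul_inv, mul_comm, hb]
  rw [he, hs]
  have h2 : Real.exp 1 / √2 * (√2 * √b * (Real.exp (-b) * b ^ (n + 1))) =
      Real.exp 1 * √b * (Real.exp (-b) * b ^ (n + 1)) := by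
    have : √2 ≠ 0 := by positivity
    field_simp
  rw [h2]
  gcongr

/-! ### Counting matchings from a nearly uniform fractional matching. -/

section Pairings

variable {V : Type*}

theorem sum_color_true_eq_false [Fintype V] (h : Sym2 V → ℝ) (c : V → Bool)
    (hc : ∀ u v, c u = c v → h s(u, v) = 0) :
    ∑ u with c u = true, ∑ v, h s(u, v) = ∑ u with c u = false, ∑ v, h s(u, v) := by
  simp only [Finset.sum_filter]
  have h1 : ∀ u, (if c u = true then ∑ v, h s(u, v) else 0) =
      ∑ v, if c u = true ∧ c v = false then h s(u, v) else 0 := by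
    intro u
    split_ifs with hu
    · refine Finset.sum_congr rfl fun v _ => ?_
      by_cases hv : c v = true
      · simp [hc u v (hu.trans hv.symm), hv]
      · simp [hu, hv]
    · simp [hu]
  have h2 : ∀ u, (if c u = false then ∑ v, h s(u, v) else 0) =
      ∑ v, if c v = true ∧ c u = false then h s(v, u) else 0 := by
    intro u
    split_ifs with hu
    · refine Finset.sum_congr rfl fun v _ => ?_
      by_cases hv : c v = false
      · simp [hc u v (hu.trans hv.symm), hv]
      · simp [hu, hv, Sym2.eq_swap]
    · simp [hu]
  simp only [h1, h2]
  exact Finset.sum_comm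

variable [DecidableEq V]

/-- Each edge covers exactly one vertex of each colour. Hence prescribing the number of uncovered
`true` vertices prescribes the number of edges. -/
theorem card_uncovered_add_card {S : Finset V} {M : Finset (Sym2 V)} (hM : M ∈ pairings S)
    (c : V → Bool) (hc : ∀ u v, s(u, v) ∈ M → c u ≠ c v) (b : Bool) :
    ((uncovered S M).filter fun v => c v = b).card + M.card =
      (S.filter fun v => c v = b).card := by
  rw [mem_pairings] at hM
  have h1 : S.filter (fun v => c v = b) = (uncovered S M).filter (fun v => c v = b) ∪
      M.biUnion fun e => S.filter fun v => c v = b ∧ v ∈ e := by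
    ext v
    simp only [Finset.mem_filter, Finset.mem_union, mem_uncovered, Finset.mem_biUnion]
    by_cases h : ∃ e ∈ M, v ∈ e
    · obtain ⟨e, he, hv⟩ := h
      constructor
      · exact fun h => Or.inr ⟨e, he, h.1, h.2, hv⟩
      · rintro (h | ⟨f, _, h⟩)
        exacts [absurd hv (h.1.2 e he), ⟨h.1, h.2.1⟩]
    · push Not at h
      constructor
      · exact fun h' => Or.inl ⟨⟨h'.1, h⟩, h'.2⟩
      · rintro (h | ⟨f, _, h⟩)
        exacts [⟨h.1.1, h.2⟩, ⟨h.1, h.2.1⟩]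
  rw [h1, Finset.card_union_of_disjoint, Finset.card_biUnion, Finset.sum_congr rfl
    (g := fun _ => 1)]
  · simp
  · intro e he
    induction e with
    | h u v =>
    have hne := hc u v he
    have hu := hM.1 _ he u (Sym2.mem_mk_left u v)
    have hv := hM.1 _ he v (Sym2.mem_mk_right u v)
    rw [Finset.card_eq_one]
    by_cases hb : c u = b
    · refine ⟨u, ?_⟩
      ext x
      simp only [Finset.mem_filter, Sym2.mem_iff, Finset.mem_singleton]
      constructor
      · rintro ⟨_, h, rfl | rfl⟩
        exacts [rfl, absurd (hb.trans h.symm) hne]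
      · rintro rfl
        exact ⟨hu, hb, Or.inl rfl⟩
    · have hb' : c v = b := by
        revert hne hb
        cases c u <;> cases c v <;> cases b <;> simp
      refine ⟨v, ?_⟩
      ext x
      simp only [Finset.mem_filter, Sym2.mem_iff, Finset.mem_singleton]
      constructor
      · rintro ⟨_, h, rfl | rfl⟩
        exacts [absurd h hb, rfl]
      · rintro rfl
        exact ⟨hv, hb', Or.inr rfl⟩
  · intro e he f hf hef
    rw [Function.onFun, Finset.disjoint_left]
    intro v hv hv'
    rw [Finset.mem_filter] at hv hv'
    exact hef (hM.2.2 e he f hf v hv.2.2 hv'.2.2)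
  · rw [Finset.disjoint_left]
    intro v hv hv'
    simp only [Finset.mem_filter, mem_uncovered, Finset.mem_biUnion] at hv hv'
    obtain ⟨e, he, h⟩ := hv'
    exact hv.1.2 e he h.2.2

theorem card_filter_touching_le {S : Finset V} {M : Finset (Sym2 V)} (hM : M ∈ pairings S)
    (X : Finset V) : (M.filter fun e => ∃ v ∈ X, v ∈ e).card ≤ X.card := by
  rw [mem_pairings] at hM
  refine Finset.card_le_card_of_forall_subsingleton (fun e v => v ∈ e) ?_ ?_
  · intro e he
    exact (Finset.mem_filter.1 he).2
  · rintro v _ e ⟨he, hve⟩ f ⟨hf, hvf⟩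
    exact hM.2.2 e (Finset.mem_filter.1 he).1 f (Finset.mem_filter.1 hf).1 v hve hvf

/-- At most `X.card` edges of a pairing meet the exceptional set `X`; they are bounded by 1, all
others by `exp Λ`. -/
theorem prod_weight_le {S : Finset V} {M : Finset (Sym2 V)} (hM : M ∈ pairings S)
    {x : Sym2 V → ℝ} (hx : ∀ e, 0 ≤ x e) (hx1 : ∀ e, x e ≤ 1) (X : Finset V) {Λ : ℝ} (hΛ : Λ ≤ 0)
    (h : ∀ e ∈ M, (∀ v ∈ e, v ∉ X) → x e ≤ Real.exp Λ) :
    ∏ e ∈ M, x e ≤ Real.exp (Λ * (M.card - X.card)) := by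
  have h1 : ∏ e ∈ M, x e ≤ ∏ e ∈ M, if ∃ v ∈ X, v ∈ e then 1 else Real.exp Λ := by
    refine Finset.prod_le_prod (fun e _ => hx e) fun e he => ?_
    split_ifs with hX
    · exact hx1 e
    · exact h e he fun v hv hvX => hX ⟨v, hvX, hv⟩
  refine h1.trans ?_
  rw [Finset.prod_ite, Finset.prod_const_one, one_mul, Finset.prod_const, ← Real.exp_nat_mul,
    Real.exp_le_exp, mul_comm]
  refine mul_le_mul_of_nonpos_left ?_ hΛ
  have h2 := card_filter_touching_le hM X
  have h3 := Finset.card_filter_add_card_filter_not (s := M) (fun e => ∃ v ∈ X, v ∈ e)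
  rw [sub_le_iff_le_add]
  exact_mod_cast (by omega : M.card ≤ _ + X.card)

theorem prod_monomer_le {U : Finset V} {g : V → ℝ} (hg : ∀ v, 0 ≤ g v) (hg1 : ∀ v, g v ≤ 1)
    (X : Finset V) {L : ℝ} (hL : L ≤ 0) (h : ∀ v, v ∉ X → g v ≤ Real.exp L) :
    ∏ v ∈ U, g v ≤ Real.exp (L * (U.card - X.card)) := by
  have h1 : ∏ v ∈ U, g v ≤ ∏ v ∈ U, if v ∈ X then 1 else Real.exp L := by
    refine Finset.prod_le_prod (fun e _ => hg e) fun v _ => ?_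
    split_ifs with hX
    · exact hg1 v
    · exact h v hX
  refine h1.trans ?_
  rw [Finset.prod_ite, Finset.prod_const_one, one_mul, Finset.prod_const, ← Real.exp_nat_mul,
    Real.exp_le_exp, mul_comm]
  refine mul_le_mul_of_nonpos_left ?_ hL
  have h2 : (U.filter (· ∈ X)).card ≤ X.card :=
    Finset.card_le_card fun v hv => (Finset.mem_filter.1 hv).2
  have h3 := Finset.card_filter_add_card_filter_not (s := U) (· ∈ X)
  rw [sub_le_iff_le_add]
  exact_mod_cast (by omega : U.card ≤ _ + X.card)

variable [Fintype V]

theorem sum_incident (h : Sym2 V → ℝ) (u : V) :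
    ∑ e with u ∈ e, h e = ∑ v, h s(u, v) := by
  symm
  refine Finset.sum_bij (fun v _ => s(u, v)) ?_ ?_ ?_ ?_
  · simp
  · intro v _ v' _ h
    exact Sym2.congr_right.1 h
  · intro e he
    obtain ⟨v, rfl⟩ := (Finset.mem_filter.1 he).2
    exact ⟨v, Finset.mem_univ _, rfl⟩
  · simp

theorem two_mul_sum_sym2 (h : Sym2 V → ℝ) (hd : ∀ v, h s(v, v) = 0) :
    2 * ∑ e, h e = ∑ u, ∑ v, h s(u, v) := by
  simp only [← sum_incident, Finset.sum_filter]
  rw [Finset.sum_comm, Finset.mul_sum]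
  refine Finset.sum_congr rfl fun e _ => ?_
  induction e with
  | h u v =>
    by_cases huv : u = v
    · subst huv
      simp [hd]
    · rw [← Finset.sum_filter, Finset.sum_const, nsmul_eq_mul]
      have : (Finset.univ.filter fun x => x ∈ s(u, v)) = {u, v} := by
        ext x
        simp
      rw [this, Finset.card_pair huv]
      norm_num

theorem sum_touching_le (h : Sym2 V → ℝ) (h0 : ∀ e, 0 ≤ h e) (X : Finset V) :
    ∑ e with ∃ v ∈ X, v ∈ e, h e ≤ ∑ u ∈ X, ∑ v, h s(u, v) := by
  simp only [← sum_incident]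
  simp only [Finset.sum_filter]
  rw [Finset.sum_comm]
  refine Finset.sum_le_sum fun e _ => ?_
  split_ifs with he
  · obtain ⟨v, hv, hve⟩ := he
    have := Finset.single_le_sum (f := fun v => if v ∈ e then h e else 0) (fun x _ => by
      split_ifs
      exacts [h0 e, le_rfl]) hv
    simpa [hve] using this
  · exact Finset.sum_nonneg fun x _ => by
      split_ifs
      exacts [h0 e, le_rfl]

/-- Pairings of size `k` inside the support of the weight `x`. -/
noncomputable def supportPairings (x : Sym2 V → ℝ) (k : ℕ) : Finset (Finset (Sym2 V)) := by
  classical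
  exact (pairings Finset.univ).filter fun M => M.card = k ∧ ∀ e ∈ M, x e ≠ 0

theorem mem_supportPairings {x : Sym2 V → ℝ} {k : ℕ} {M : Finset (Sym2 V)} :
    M ∈ supportPairings x k ↔ IsPairing M ∧ M.card = k ∧ ∀ e ∈ M, x e ≠ 0 := by
  simp [supportPairings, mem_pairings]

/-- An edge of weight `δ` away from `X` contributes exactly `exp φ`, written as `exp (φ / δ * x₀ e)`
to be linear in `x₀`; the total weight is at most half the number of vertices. Edges meeting `X`
have total weight at most `X.card` and cost at most its exponential. -/
theorem exp_le_prod_bethe {x₀ : Sym2 V → ℝ} (hx₀ : ∀ e, 0 ≤ x₀ e)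
    (hd : ∀ v, x₀ s(v, v) = 0) (hrow : ∀ u, ∑ v, x₀ s(u, v) ≤ 1) (X : Finset V) {δ s : ℝ}
    (hδ : 0 < δ) (hs : 0 < s) (hs1 : s ≤ 1) (hsδ : s * δ < 1)
    (hX : ∀ e, (∀ v ∈ e, v ∉ X) → x₀ e = 0 ∨ x₀ e = δ) :
    Real.exp (Fintype.card V / (2 * δ) * ((1 - s * δ) * Real.log (1 - s * δ)) - X.card) ≤
      ∏ e, (1 - s * x₀ e) ^ (1 - s * x₀ e) := by
  set φ := (1 - s * δ) * Real.log (1 - s * δ) with hφ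
  have hφ0 : φ ≤ 0 := mul_nonpos_of_nonneg_of_nonpos (by linarith)
    (Real.log_nonpos (by linarith) (by nlinarith))
  have hx1 : ∀ e, x₀ e ≤ 1 := fun e => by
    induction e with
    | h u v => exact (Finset.single_le_sum (f := fun v => x₀ s(u, v)) (fun v _ => hx₀ _)
        (Finset.mem_univ v)).trans (hrow u)
  have h1 : ∀ e, Real.exp (φ / δ * x₀ e - if ∃ v ∈ X, v ∈ e then x₀ e else 0) ≤
      (1 - s * x₀ e) ^ (1 - s * x₀ e) := by
    intro e
    split_ifs with he
    · refine le_trans ?_ (exp_neg_le_one_sub_rpow (by nlinarith [hx₀ e, hx1 e]))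
      rw [Real.exp_le_exp]
      have : φ / δ * x₀ e ≤ 0 :=
        mul_nonpos_of_nonpos_of_nonneg (div_nonpos_of_nonpos_of_nonneg hφ0 hδ.le) (hx₀ e)
      nlinarith [hx₀ e]
    · rcases hX e fun v hv hvX => he ⟨v, hvX, hv⟩ with h | h
      · simp [h]
      · rw [h, Real.rpow_def_of_pos (by linarith), sub_zero, div_mul_cancel₀ _ hδ.ne', hφ, mul_comm]
  refine le_trans ?_ (Finset.prod_le_prod (fun _ _ => (Real.exp_pos _).le) fun e _ => h1 e)
  rw [← Real.exp_sum, Real.exp_le_exp, Finset.sum_sub_distrib, ← Finset.mul_sum,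
    ← Finset.sum_filter]
  have h2 : ∑ e with ∃ v ∈ X, v ∈ e, x₀ e ≤ X.card :=
    (sum_touching_le x₀ hx₀ X).trans ((Finset.sum_le_sum fun u _ => hrow u).trans (by simp))
  have h3 : 2 * ∑ e, x₀ e ≤ Fintype.card V := by
    rw [two_mul_sum_sym2 x₀ hd]
    exact (Finset.sum_le_sum fun u _ => hrow u).trans (by simp)
  have h4 : Fintype.card V / (2 * δ) * φ ≤ φ / δ * ∑ e, x₀ e := by
    have h5 : ∑ e, x₀ e ≤ Fintype.card V / 2 := by linarith
    have := mul_le_mul_of_nonpos_left h5 (div_nonpos_of_nonpos_of_nonneg hφ0 hδ.le)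
    refine le_of_eq_of_le ?_ this
    field_simp
  linarith

/-- A lower bound for the number of `k`-matchings of a bipartite graph that carries a nearly
uniform fractional matching of total weight `k / s`. -/
theorem log_card_supportPairings_ge {x₀ : Sym2 V → ℝ} (hx₀ : ∀ e, 0 ≤ x₀ e) (c : V → Bool)
    (hc : ∀ u v, c u = c v → x₀ s(u, v) = 0) (hrow : ∀ u, ∑ v, x₀ s(u, v) ≤ 1) (X : Finset V)
    (hrowX : ∀ u ∉ X, ∑ v, x₀ s(u, v) = 1) {δ s L : ℝ} {k : ℕ}
    (hδ : 0 < δ) (hs : 0 < s) (hs1 : s ≤ 1) (hsδ : s * δ < 1)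
    (hX : ∀ e, (∀ v ∈ e, v ∉ X) → x₀ e = 0 ∨ x₀ e = δ)
    (hk : s * ∑ u, ∑ v, x₀ s(u, v) = 2 * k) (hL : L ≤ 0) (hsL : 1 - s ≤ Real.exp L)
    (hV : 0 < Fintype.card V) :
    Fintype.card V / (2 * δ) * ((1 - s * δ) * Real.log (1 - s * δ)) - X.card
      - 1 - Real.log (Fintype.card V) - Real.log (s * δ) * (k - X.card)
      - L * (Fintype.card V - 2 * k - X.card) ≤ Real.log (supportPairings x₀ k).card := by
  set N : ℝ := (Fintype.card V : ℝ) with hN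
  have hN1 : 1 ≤ N := Nat.one_le_cast.2 hV
  set x : Sym2 V → ℝ := fun e => s * x₀ e with hx
  set g : V → ℝ := fun u => 1 - ∑ v, x s(u, v) with hg
  have hx0 : ∀ e, 0 ≤ x e := fun e => mul_nonneg hs.le (hx₀ e)
  have hxrow : ∀ u, ∑ v, x s(u, v) = s * ∑ v, x₀ s(u, v) := fun u => by
    simp only [hx, Finset.mul_sum]
  have hxrow1 : ∀ u, ∑ v, x s(u, v) ≤ 1 := fun u => by
    rw [hxrow]
    exact mul_le_one₀ hs1 (Finset.sum_nonneg fun v _ => hx₀ _) (hrow u)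
  have hxrow0 : ∀ u, 0 ≤ ∑ v, x s(u, v) := fun u => Finset.sum_nonneg fun v _ => hx0 _
  have hg0 : ∀ u, 0 ≤ g u := fun u => sub_nonneg.2 (hxrow1 u)
  have hg1 : ∀ u, g u ≤ 1 := fun u => sub_le_self _ (hxrow0 u)
  have hx1 : ∀ e, x e ≤ 1 := fun e => by
    induction e with
    | h u v => exact (Finset.single_le_sum (f := fun v => x s(u, v)) (fun v _ => hx0 _)
        (Finset.mem_univ v)).trans (hxrow1 u)
  have hxc : ∀ u v, c u = c v → x s(u, v) = 0 := fun u v h => by simp [hx, hc u v h]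
  have htf := sum_color_true_eq_false x c hxc
  have htot : ∑ u with c u = true, ∑ v, x s(u, v) = k := by
    have h1 : ∑ u, ∑ v, x s(u, v) = 2 * k := by
      rw [← hk, Finset.mul_sum]
      exact Finset.sum_congr rfl fun u _ => hxrow u
    rw [← Finset.sum_filter_add_sum_filter_not Finset.univ (fun u => c u = true)] at h1
    simp only [Bool.not_eq_true] at h1
    linarith
  set nL := (Finset.univ.filter fun u => c u = true).card with hnL
  set nR := (Finset.univ.filter fun u => c u = false).card with hnR
  have hLR : nL + nR = Fintype.card V := by
    have := Finset.card_filter_add_card_filter_not (s := (Finset.univ : Finset V))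
      (fun u => c u = true)
    simpa [Bool.not_eq_true] using this
  have hkL : k ≤ nL := by
    have : (k : ℝ) ≤ nL := by
      rw [← htot]
      exact (Finset.sum_le_sum fun u _ => hxrow1 u).trans (by simp [hnL])
    exact_mod_cast this
  -- The scaling by `s` makes the total edge weight equal to `k`, so the slack on the `true` side is
  -- this integer, and leaving `a` such vertices uncovered means having `k` edges.
  set a := nL - k with ha
  have hgsum : ∑ u with c u = true, g u = (a : ℝ) := by
    simp only [hg, Finset.sum_sub_distrib, htot]
    rw [ha, Nat.cast_sub hkL]
    simp [hnL]
  have hmain := prod_le_partitionFnDefect hx0 hg0 c hxc (fun u => by simp [hg]) a hgsum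
  -- Away from `X` all edges weigh `s * δ` and all monomers `1 - s`, so every contributing matching
  -- has weight at most one common value.
  have hbound : partitionFnDefect x g c a Finset.univ ≤ (supportPairings x₀ k).card *
      Real.exp (Real.log (s * δ) * (k - X.card) + L * (N - 2 * k - X.card)) := by
    have hsupp : partitionFnDefect x g c a Finset.univ =
        ∑ M ∈ (pairings Finset.univ).filter (fun M =>
          ((uncovered Finset.univ M).filter fun v => c v = true).card = a) with
          ∏ e ∈ M, x e ≠ 0, (∏ e ∈ M, x e) * ∏ v ∈ uncovered Finset.univ M, g v := by
      unfold partitionFnDefect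
      symm
      refine Finset.sum_filter_of_ne fun M _ h h' => h ?_
      rw [h', zero_mul]
    have hM : ∀ M ∈ ((pairings Finset.univ).filter (fun M =>
          ((uncovered Finset.univ M).filter fun v => c v = true).card = a)).filter
          (fun M => ∏ e ∈ M, x e ≠ 0), M ∈ supportPairings x₀ k ∧
          (∏ e ∈ M, x e) * ∏ v ∈ uncovered Finset.univ M, g v ≤
            Real.exp (Real.log (s * δ) * (k - X.card) + L * (N - 2 * k - X.card)) := by
      intro M hM
      simp only [Finset.mem_filter, Finset.prod_ne_zero_iff] at hM
      obtain ⟨⟨hM, hcard⟩, hne⟩ := hM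
      have hbi : ∀ u v, s(u, v) ∈ M → c u ≠ c v := fun u v h h' => hne _ h (hxc u v h')
      have h1 := card_uncovered_add_card hM c hbi true
      have h2 := card_uncovered_add_card hM c hbi false
      have h3 := Finset.card_filter_add_card_filter_not (s := uncovered Finset.univ M)
        (fun u => c u = true)
      simp only [Bool.not_eq_true] at h3
      have hMk : M.card = k := by omega
      have hU : ((uncovered Finset.univ M).card : ℝ) = N - 2 * k := by
        have : (uncovered Finset.univ M).card + 2 * k = Fintype.card V := by omega
        rw [hN, ← this]
        push_cast
        ring
      refine ⟨mem_supportPairings.2 ⟨(mem_pairings.1 hM).2, hMk, fun e he h => hne e he ?_⟩, ?_⟩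
      · simp [hx, h]
      · rw [Real.exp_add]
        refine mul_le_mul ?_ ?_ (Finset.prod_nonneg fun v _ => hg0 v) (Real.exp_pos _).le
        · rw [← hMk]
          refine prod_weight_le hM hx0 hx1 X
            (Real.log_nonpos (by positivity) hsδ.le) fun e he h => ?_
          rw [Real.exp_log (by positivity)]
          rcases hX e h with h | h
          · simp only [hx, h]
            nlinarith [mul_pos hs hδ]
          · simp [hx, h]
        · rw [← hU]
          refine prod_monomer_le hg0 hg1 X hL fun v hv => ?_
          simp only [hg, hxrow, hrowX v hv, mul_one]
          exact hsL
    rw [hsupp, ← nsmul_eq_mul]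
    refine (Finset.sum_le_card_nsmul _ _ _ fun M h => (hM M h).2).trans ?_
    exact nsmul_le_nsmul_left (Real.exp_pos _).le (Finset.card_le_card fun M h => (hM M h).1)
  have hbethe := exp_le_prod_bethe hx₀ (fun v => hc v v rfl) hrow X hδ hs hs1 hsδ hX
  set K := N / (2 * δ) * ((1 - s * δ) * Real.log (1 - s * δ)) - X.card with hK
  set Q := Real.log (s * δ) * (k - X.card) + L * (N - 2 * k - X.card) with hQ
  set m : ℝ := ((supportPairings x₀ k).card : ℝ) with hm
  have hfac : (a.factorial : ℝ) ≤ Real.exp 1 * N * (Real.exp (-a) * (a : ℝ) ^ a) := by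
    rcases eq_or_ne a 0 with h0 | h0
    · rw [h0]
      simp only [Nat.factorial_zero, Nat.cast_one, Nat.cast_zero, neg_zero, Real.exp_zero,
        pow_zero, mul_one]
      nlinarith [Real.one_lt_exp_iff.2 one_pos]
    · refine (factorial_le_stirling h0).trans ?_
      have : (a : ℝ) ≤ N := by
        rw [hN]
        exact_mod_cast (by omega : a ≤ Fintype.card V)
      gcongr
  have hea : 0 < Real.exp (-a) * (a : ℝ) ^ a := by
    rcases eq_or_ne a 0 with h0 | h0
    · simp [h0]
    · positivity
  have hm0 : 0 ≤ m := by positivity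
  have hfin : Real.exp K ≤ Real.exp 1 * N * (m * Real.exp Q) := by
    refine le_of_mul_le_mul_right ?_ hea
    calc Real.exp K * (Real.exp (-a) * (a : ℝ) ^ a)
        ≤ (∏ e, (1 - x e) ^ (1 - x e)) * (Real.exp (-a) * (a : ℝ) ^ a) :=
          mul_le_mul_of_nonneg_right hbethe hea.le
      _ ≤ a.factorial * partitionFnDefect x g c a Finset.univ := by rw [← mul_assoc]; exact hmain
      _ ≤ a.factorial * (m * Real.exp Q) := mul_le_mul_of_nonneg_left hbound (by positivity)
      _ ≤ Real.exp 1 * N * (Real.exp (-a) * (a : ℝ) ^ a) * (m * Real.exp Q) :=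
          mul_le_mul_of_nonneg_right hfac (by positivity)
      _ = _ := by ring
  have hmpos : 0 < m := by
    rcases hm0.eq_or_lt with h | h
    · rw [← h] at hfin
      have := Real.exp_pos K
      simp only [zero_mul, mul_zero] at hfin
      linarith
    · exact h
  have hlog := Real.log_le_log (Real.exp_pos K) hfin
  rw [Real.log_exp, Real.log_mul (by positivity) (by positivity),
    Real.log_mul (by positivity) (by positivity), Real.log_mul (by positivity) (by positivity),
    Real.log_exp, Real.log_exp] at hlog
  linarith

end Pairings

/-! ### Pairings as matchings of a graph. -/

section Matchings

variable {V : Type*}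

/-- The subgraph of `G` whose edges are those in `M`. -/
def subgraphOfPairing (G : SimpleGraph V) (M : Finset (Sym2 V)) : G.Subgraph where
  verts := {v | ∃ w, s(v, w) ∈ M ∧ G.Adj v w}
  Adj u v := s(u, v) ∈ M ∧ G.Adj u v
  adj_sub h := h.2
  edge_vert h := ⟨_, h⟩
  symm := ⟨fun _ _ h => ⟨Sym2.eq_swap ▸ h.1, h.2.symm⟩⟩

theorem edgeSet_subgraphOfPairing {G : SimpleGraph V} {M : Finset (Sym2 V)}
    (h : ∀ e ∈ M, e ∈ G.edgeSet) : (subgraphOfPairing G M).edgeSet = M := by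
  ext e
  induction e with
  | h u v =>
    rw [SimpleGraph.Subgraph.mem_edgeSet]
    exact ⟨fun h => h.1, fun h' => ⟨h', h _ h'⟩⟩

variable [DecidableEq V] [Fintype V]

theorem card_supportPairings_le {G : SimpleGraph V} {x : Sym2 V → ℝ}
    (hx : ∀ e, x e ≠ 0 → e ∈ G.edgeSet) (k : ℕ) :
    (supportPairings x k).card ≤
      {M : G.Subgraph | M.IsMatching ∧ M.edgeSet.ncard = k}.ncard := by
  classical
  rw [← Set.ncard_coe_finset]
  refine Set.ncard_le_ncard_of_injOn (subgraphOfPairing G) ?_ ?_ (Set.toFinite _)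
  · intro M hM
    rw [Finset.mem_coe, mem_supportPairings] at hM
    obtain ⟨hM, hk, hne⟩ := hM
    refine ⟨?_, ?_⟩
    · rintro v ⟨w, hw⟩
      refine ⟨w, hw, fun w' hw' => ?_⟩
      exact (Sym2.congr_right.1 (hM.2 _ hw.1 _ hw'.1 v (Sym2.mem_mk_left _ _)
        (Sym2.mem_mk_left _ _))).symm
    · rw [edgeSet_subgraphOfPairing fun e he => hx e (hne e he), Set.ncard_coe_finset, hk]
  · intro M hM M' hM' h
    rw [Finset.mem_coe, mem_supportPairings] at hM hM'
    have := congrArg SimpleGraph.Subgraph.edgeSet h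
    rw [edgeSet_subgraphOfPairing fun e he => hx e (hM.2.2 e he),
      edgeSet_subgraphOfPairing fun e he => hx e (hM'.2.2 e he)] at this
    exact_mod_cast this

end Matchings

/-! ### Dart systems and their fractional matchings. -/

section DartSystem

variable {V σ : Type*} [DecidableEq V] [Fintype σ]

/-- A multigraph (with loops) on `V` in which every vertex has one dart for each label in `σ`: the
dart labelled `s` at `u` leads to `next s u`, where the reversed dart is labelled `back s u`. -/
structure DartSystem (V σ : Type*) where
  next : σ → V → V
  back : σ → V → σ
  next_back : ∀ s u, next (back s u) (next s u) = u
  back_back : ∀ s u, back (back s u) (next s u) = s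

namespace DartSystem

variable (T : DartSystem V σ)

theorem card_symm (u v : V) : (Finset.univ.filter fun s => T.next s u = v).card =
    (Finset.univ.filter fun s => T.next s v = u).card := by
  refine Finset.card_bij' (fun s _ => T.back s u) (fun s _ => T.back s v) ?_ ?_ ?_ ?_
  · intro s hs
    rw [Finset.mem_filter] at hs ⊢
    refine ⟨Finset.mem_univ _, ?_⟩
    rw [← hs.2]
    exact T.next_back s u
  · intro s hs
    rw [Finset.mem_filter] at hs ⊢
    refine ⟨Finset.mem_univ _, ?_⟩
    rw [← hs.2]
    exact T.next_back s v
  · intro s hs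
    rw [Finset.mem_filter] at hs
    rw [← hs.2]
    exact T.back_back s u
  · intro s hs
    rw [Finset.mem_filter] at hs
    rw [← hs.2]
    exact T.back_back s v

/-- The normalized edge multiplicities; loops are dropped. -/
noncomputable def weight : Sym2 V → ℝ :=
  Sym2.lift ⟨fun u v => if u = v then 0 else
    ((Finset.univ.filter fun s => T.next s u = v).card : ℝ) / Fintype.card σ, fun u v => by
      simp only [T.card_symm u v, eq_comm (a := u)]⟩

theorem weight_mk (u v : V) : T.weight s(u, v) = if u = v then 0 else
    ((Finset.univ.filter fun s => T.next s u = v).card : ℝ) / Fintype.card σ := rfl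

theorem weight_nonneg (e : Sym2 V) : 0 ≤ T.weight e := by
  induction e with
  | h u v =>
    rw [weight_mk]
    split_ifs <;> positivity

theorem exists_next_of_weight_ne_zero {u v : V} (h : T.weight s(u, v) ≠ 0) :
    u ≠ v ∧ ∃ s, T.next s u = v := by
  rw [weight_mk] at h
  split_ifs at h with huv
  · exact absurd rfl h
  · refine ⟨huv, ?_⟩
    by_contra! hs
    exact h (by simp [hs])

theorem sum_weight [Fintype V] (u : V) : ∑ v, T.weight s(u, v) =
    ((Finset.univ.filter fun s => T.next s u ≠ u).card : ℝ) / Fintype.card σ := by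
  simp only [weight_mk]
  have h : ∀ v, (if u = v then (0 : ℝ) else
      ((Finset.univ.filter fun s => T.next s u = v).card : ℝ) / Fintype.card σ) =
      ((((Finset.univ.filter fun s => T.next s u ≠ u).filter fun s => T.next s u = v).card : ℕ) : ℝ)
        / Fintype.card σ := by
    intro v
    rw [Finset.filter_filter]
    split_ifs with huv
    · subst huv
      simp
    · congr 3
      ext s
      simp only [Finset.mem_filter, Finset.mem_univ, true_and]
      exact ⟨fun h => ⟨fun h' => huv (h'.symm.trans h), h⟩, fun h => h.2⟩
  rw [Finset.sum_congr rfl fun v _ => h v, ← Finset.sum_div, ← Nat.cast_sum,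
    ← Finset.card_eq_sum_card_fiberwise fun _ _ => Finset.mem_coe.2 (Finset.mem_univ _)]

theorem sum_weight_le_one [Fintype V] (u : V) : ∑ v, T.weight s(u, v) ≤ 1 := by
  rw [sum_weight]
  refine div_le_one_of_le₀ ?_ (by positivity)
  exact_mod_cast Finset.card_filter_le _ _

theorem sum_weight_eq_one [Fintype V] [Nonempty σ] {u : V} (h : ∀ s, T.next s u ≠ u) :
    ∑ v, T.weight s(u, v) = 1 := by
  rw [sum_weight, Finset.filter_true_of_mem fun s _ => h s, Finset.card_univ, div_self]
  exact_mod_cast Fintype.card_ne_zero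

theorem weight_eq_zero_or {u : V} (h : Function.Injective fun s => T.next s u) (v : V) :
    T.weight s(u, v) = 0 ∨ T.weight s(u, v) = 1 / Fintype.card σ := by
  rw [weight_mk]
  split_ifs
  · exact Or.inl rfl
  · have : (Finset.univ.filter fun s => T.next s u = v).card ≤ 1 :=
      Finset.card_le_one.2 fun s hs s' hs' =>
        h ((Finset.mem_filter.1 hs).2.trans (Finset.mem_filter.1 hs').2.symm)
    interval_cases (Finset.univ.filter fun s => T.next s u = v).card <;> simp

end DartSystem

end DartSystem

/-! ### The box, its boundary layer and the lattice steps. -/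

section Box

variable {d : ℕ}

theorem mem_latticeBox {m : Fin d → ℕ} {x : Fin d → ℤ} :
    x ∈ latticeBox m ↔ ∀ i, 1 ≤ x i ∧ x i ≤ m i := Iff.rfl

noncomputable instance latticeBoxFintype (m : Fin d → ℕ) : Fintype (latticeBox m) :=
  Fintype.ofFinset (Fintype.piFinset fun i => Finset.Icc (1 : ℤ) (m i)) fun x => by
    simp [mem_latticeBox]

theorem card_latticeBox (m : Fin d → ℕ) : Fintype.card (latticeBox m) = ∏ i, m i := by
  rw [Fintype.card_of_finset' (Fintype.piFinset fun i => Finset.Icc (1 : ℤ) (m i)) fun x => by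
    simp [mem_latticeBox], Fintype.card_piFinset]
  simp

/-- The sites at distance at most `1` from the boundary. -/
noncomputable def boundaryLayer (m : Fin d → ℕ) : Finset (latticeBox m) :=
  Finset.univ.filter fun u => ∃ i, u.1 i ≤ 1 ∨ (m i : ℤ) - 1 ≤ u.1 i

theorem notMem_boundaryLayer {m : Fin d → ℕ} {u : latticeBox m} :
    u ∉ boundaryLayer m ↔ ∀ i, 2 ≤ u.1 i ∧ u.1 i ≤ (m i : ℤ) - 2 := by
  simp only [boundaryLayer, Finset.mem_filter, Finset.mem_univ, true_and, not_exists, not_or,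
    not_le]
  exact forall_congr' fun i => by omega

/-- The remaining sites form the product of the intervals from 2 to `m i - 2`; truncated subtraction
is correct for short sides. -/
theorem card_boundaryLayer (m : Fin d → ℕ) :
    (boundaryLayer m).card + ∏ i, (m i - 3) = ∏ i, m i := by
  have h1 : ∏ i, (m i - 3) = ((Finset.univ : Finset (latticeBox m)).filter
      fun u => u ∉ boundaryLayer m).card := by
    rw [← Finset.card_map (Function.Embedding.subtype _)]
    have : ∏ i, (m i - 3) = (Fintype.piFinset fun i => Finset.Icc (2 : ℤ) (m i - 2)).card := by
      rw [Fintype.card_piFinset]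
      refine Finset.prod_congr rfl fun i _ => ?_
      rw [Int.card_Icc]
      omega
    rw [this]
    congr 1
    ext x
    simp only [Fintype.mem_piFinset, Finset.mem_Icc, Finset.mem_map, Finset.mem_filter,
      Finset.mem_univ, true_and, notMem_boundaryLayer, Function.Embedding.subtype_apply]
    constructor
    · exact fun h => ⟨⟨x, fun i => by have := h i; omega⟩, h, rfl⟩
    · rintro ⟨u, hu, rfl⟩
      exact hu
  rw [h1, ← card_latticeBox, ← Finset.card_univ,
    ← Finset.card_filter_add_card_filter_not (s := (Finset.univ : Finset (latticeBox m)))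
      (· ∈ boundaryLayer m)]
  simp

/-- The parity of a site. -/
def siteColor {m : Fin d → ℕ} (u : latticeBox m) : Bool := decide (Even (∑ i, u.1 i))

theorem boxGraph_adj {m : Fin d → ℕ} {u v : latticeBox m} :
    (boxGraph m).Adj u v ↔ ∑ i, |u.1 i - v.1 i| = 1 := Iff.rfl

theorem siteColor_ne_of_adj {m : Fin d → ℕ} {u v : latticeBox m} (h : (boxGraph m).Adj u v) :
    siteColor u ≠ siteColor v := by
  rw [boxGraph_adj] at h
  have h1 : Even (∑ i, |u.1 i - v.1 i| - (∑ i, u.1 i - ∑ i, v.1 i)) := by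
    rw [← Finset.sum_sub_distrib, ← Finset.sum_sub_distrib]
    refine Finset.even_sum _ fun i _ => ?_
    rcases abs_choice (u.1 i - v.1 i) with h | h <;> rw [h]
    · simp
    · exact ⟨-(u.1 i - v.1 i), by ring⟩
  rw [h] at h1
  intro h2
  have h3 : Even (∑ i, u.1 i) ↔ Even (∑ i, v.1 i) := by simpa [siteColor] using h2
  rw [Int.even_sub, Int.even_sub] at h1
  simp [h3] at h1

theorem adj_of_eq_add_single {m : Fin d → ℕ} {u v : latticeBox m} {i : Fin d} {ε : ℤ}
    (hε : |ε| = 1) (h : v.1 = u.1 + Pi.single i ε) : (boxGraph m).Adj u v := by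
  rw [boxGraph_adj, h, Finset.sum_eq_single i]
  · simp [hε]
  · intro j _ hj
    simp [hj]
  · simp

/-- The neighbour of a point of `ℤ^d` in one of the `2d` directions. -/
def shift (s : Fin d × Bool) (x : Fin d → ℤ) : Fin d → ℤ :=
  x + Pi.single s.1 (if s.2 then 1 else -1)

theorem shift_apply_self (s : Fin d × Bool) (x : Fin d → ℤ) :
    shift s x s.1 = x s.1 + if s.2 then 1 else -1 := by
  simp [shift]

theorem shift_apply_of_ne (s : Fin d × Bool) (x : Fin d → ℤ) {j : Fin d} (h : j ≠ s.1) :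
    shift s x j = x j := by
  simp [shift, h]

theorem shift_shift (s : Fin d × Bool) (x : Fin d → ℤ) : shift (s.1, !s.2) (shift s x) = x := by
  obtain ⟨i, b⟩ := s
  unfold shift
  rw [add_assoc, ← Pi.single_add]
  cases b <;> simp

theorem shift_ne_self (s : Fin d × Bool) (x : Fin d → ℤ) : shift s x ≠ x := fun h => by
  have := congrFun h s.1
  rw [shift_apply_self] at this
  split_ifs at this <;> omega

theorem shift_injective (x : Fin d → ℤ) : Function.Injective fun s => shift s x := by
  rintro ⟨i, b⟩ ⟨j, b'⟩ h
  have h1 := congrFun h i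
  dsimp only at h1
  rw [shift_apply_self (i, b)] at h1
  by_cases hij : i = j
  · subst hij
    rw [shift_apply_self (i, b')] at h1
    cases b <;> cases b' <;> simp at h1 ⊢
  · rw [shift_apply_of_ne (j, b') _ hij] at h1
    cases b <;> simp at h1

theorem exists_shift_of_adj {m : Fin d → ℕ} {u v : latticeBox m} (h : (boxGraph m).Adj u v) :
    ∃ s, v.1 = shift s u.1 := by
  rw [boxGraph_adj] at h
  have h0 : ∃ i, u.1 i - v.1 i ≠ 0 := by
    by_contra! hc
    simp [hc] at h
  obtain ⟨i, hi⟩ := h0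
  rw [← Finset.add_sum_erase _ _ (Finset.mem_univ i)] at h
  have h1 : 0 ≤ ∑ j ∈ Finset.univ.erase i, |u.1 j - v.1 j| :=
    Finset.sum_nonneg fun _ _ => abs_nonneg _
  have h2 := Int.one_le_abs hi
  have h3 : ∑ j ∈ Finset.univ.erase i, |u.1 j - v.1 j| = 0 := by omega
  rw [Finset.sum_eq_zero_iff_of_nonneg fun _ _ => abs_nonneg _] at h3
  have h4 : ∀ j, j ≠ i → v.1 j = u.1 j := fun j hj => by
    have := abs_eq_zero.1 (h3 j (Finset.mem_erase.2 ⟨hj, Finset.mem_univ j⟩))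
    omega
  have h5 : |u.1 i - v.1 i| = 1 := by omega
  rcases (abs_eq one_pos.le).1 h5 with h6 | h6
  · refine ⟨(i, false), funext fun j => ?_⟩
    by_cases hj : j = i
    · subst hj
      rw [shift_apply_self (j, false)]
      simp only [Bool.false_eq_true, if_false]
      omega
    · rw [shift_apply_of_ne (i, false) _ hj, h4 j hj]
  · refine ⟨(i, true), funext fun j => ?_⟩
    by_cases hj : j = i
    · subst hj
      rw [shift_apply_self (j, true)]
      simp only [if_true]
      omega
    · rw [shift_apply_of_ne (i, true) _ hj, h4 j hj]

theorem adj_of_eq_shift {m : Fin d → ℕ} {u v : latticeBox m} {s : Fin d × Bool}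
    (h : v.1 = shift s u.1) : (boxGraph m).Adj u v :=
  adj_of_eq_add_single (by split_ifs <;> simp) h

/-- The bound `m i - 1`, rather than `m i`, keeps the neighbour inside the largest sub-box with even
sides. -/
theorem shift_mem_of_notMem_boundaryLayer {m : Fin d → ℕ} {u : latticeBox m}
    (hu : u ∉ boundaryLayer m) (s : Fin d × Bool) (i : Fin d) :
    1 ≤ shift s u.1 i ∧ shift s u.1 i ≤ (m i : ℤ) - 1 := by
  have := notMem_boundaryLayer.1 hu i
  by_cases hi : i = s.1
  · subst hi
    rw [shift_apply_self]
    split_ifs <;> omega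
  · rw [shift_apply_of_ne s _ hi]
    omega

/-- A matching is recovered from the set of directions it uses at each site. This crude bound only
serves to make the lower limit of real numbers meaningful. -/
theorem numTilings_le (m : Fin d → ℕ) (l : ℕ) :
    numTilings m l ≤ (2 ^ (2 * d)) ^ ∏ i, m i := by
  classical
  have h1 : (2 ^ (2 * d)) ^ ∏ i, m i =
      (Set.univ : Set (latticeBox m → Finset (Fin d × Bool))).ncard := by
    rw [Set.ncard_univ, Nat.card_eq_fintype_card]
    simp [mul_comm]
  rw [h1]
  refine Set.ncard_le_ncard_of_injOn (fun M u => Finset.univ.filter fun s =>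
    ∃ v : latticeBox m, v.1 = shift s u.1 ∧ M.Adj u v) (fun _ _ => Set.mem_univ _) ?_
    (Set.toFinite _)
  intro M hM M' hM' h
  have key : ∀ M : (boxGraph m).Subgraph, ∀ u v : latticeBox m, M.Adj u v ↔
      ∃ s ∈ (Finset.univ.filter fun s => ∃ v : latticeBox m, v.1 = shift s u.1 ∧ M.Adj u v),
        v.1 = shift s u.1 := by
    intro M u v
    simp only [Finset.mem_filter, Finset.mem_univ, true_and]
    constructor
    · intro h
      obtain ⟨s, hs⟩ := exists_shift_of_adj h.adj_sub
      exact ⟨s, ⟨v, hs, h⟩, hs⟩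
    · rintro ⟨s, ⟨v', hv', h⟩, hs⟩
      rwa [Subtype.ext (hs.trans hv'.symm)]
  have hadj : ∀ u v, M.Adj u v ↔ M'.Adj u v := fun u v => by
    rw [key M, key M']
    have := congrFun h u
    dsimp only at this
    rw [this]
  refine SimpleGraph.Subgraph.ext ?_ (funext fun u => funext fun v => propext (hadj u v))
  rw [← hM.1.support_eq_verts, ← hM'.1.support_eq_verts]
  ext u
  simp only [SimpleGraph.Subgraph.mem_support, hadj]

/-- The lattice darts inside the box; those that leave the box become loops. -/
def freeDarts (m : Fin d → ℕ) : DartSystem (latticeBox m) (Fin d × Bool) where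
  next s u := if h : (∀ i, 1 ≤ shift s u.1 i ∧ shift s u.1 i ≤ m i) then ⟨shift s u.1, h⟩ else u
  back s u := if (∀ i, 1 ≤ shift s u.1 i ∧ shift s u.1 i ≤ m i) then (s.1, !s.2) else s
  next_back s u := by
    by_cases h : ∀ i, 1 ≤ shift s u.1 i ∧ shift s u.1 i ≤ m i
    · have hu : ∀ i, 1 ≤ u.1 i ∧ u.1 i ≤ m i := u.2
      simp [h, shift_shift, hu]
    · simp [h]
  back_back s u := by
    by_cases h : ∀ i, 1 ≤ shift s u.1 i ∧ shift s u.1 i ≤ m i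
    · have hu : ∀ i, 1 ≤ u.1 i ∧ u.1 i ≤ m i := u.2
      simp [h, shift_shift, hu]
    · simp [h]

theorem freeDarts_next_eq_or_adj (m : Fin d → ℕ) (s : Fin d × Bool) (u : latticeBox m) :
    (freeDarts m).next s u = u ∨ (boxGraph m).Adj u ((freeDarts m).next s u) := by
  by_cases h : ∀ i, 1 ≤ shift s u.1 i ∧ shift s u.1 i ≤ m i
  · exact Or.inr (adj_of_eq_shift (s := s) (by simp [freeDarts, h]))
  · exact Or.inl (by simp [freeDarts, h])

theorem freeDarts_next_of_notMem {m : Fin d → ℕ} {u : latticeBox m} (hu : u ∉ boundaryLayer m)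
    (s : Fin d × Bool) : ((freeDarts m).next s u).1 = shift s u.1 := by
  have h : ∀ i, 1 ≤ shift s u.1 i ∧ shift s u.1 i ≤ m i := fun i => by
    have := shift_mem_of_notMem_boundaryLayer hu s i
    omega
  simp [freeDarts, h]

end Box

/-! ### Redirecting boundary darts along dominoes. -/

section Reflecting

variable {d : ℕ}

/-- The coordinates of `u` that lie in the even part `{1, …, 2 ⌊m_i / 2⌋}` of their range. -/
def evenPart {m : Fin d → ℕ} (u : latticeBox m) : Finset (Fin d) :=
  Finset.univ.filter fun i => u.1 i ≤ 2 * ((m i : ℤ) / 2)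

theorem mem_evenPart {m : Fin d → ℕ} {u : latticeBox m} {i : Fin d} :
    i ∈ evenPart u ↔ u.1 i ≤ 2 * ((m i : ℤ) / 2) := by
  simp [evenPart]

/-- The partner of a point in the domino tiling in direction `i` by the dominoes
`{2k - 1, 2k}`. -/
def domino (i : Fin d) (x : Fin d → ℤ) : Fin d → ℤ :=
  x + Pi.single i (if Odd (x i) then 1 else -1)

theorem domino_apply_self (i : Fin d) (x : Fin d → ℤ) :
    domino i x i = x i + if Odd (x i) then 1 else -1 := by
  simp [domino]

theorem domino_apply_of_ne (i : Fin d) (x : Fin d → ℤ) {j : Fin d} (h : j ≠ i) :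
    domino i x j = x j := by
  simp [domino, h]

theorem domino_domino (i : Fin d) (x : Fin d → ℤ) : domino i (domino i x) = x := by
  have h : Odd (domino i x i) ↔ ¬ Odd (x i) := by
    rw [domino_apply_self]
    split_ifs with h
    · simp [h]
    · simp only [h, not_false_eq_true, iff_true]
      rw [Int.not_odd_iff_even] at h
      exact h.add_odd (by decide)
  unfold domino at h ⊢
  rw [add_assoc, ← Pi.single_add]
  simp only [h]
  split_ifs <;> simp_all

theorem domino_ne_self (i : Fin d) (x : Fin d → ℤ) : domino i x ≠ x := fun h => by
  have := congrFun h i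
  rw [domino_apply_self] at this
  split_ifs at this <;> omega

theorem domino_bounds {m : Fin d → ℕ} (u : latticeBox m) {i : Fin d} (hi : i ∈ evenPart u) :
    1 ≤ domino i u.1 i ∧ domino i u.1 i ≤ 2 * ((m i : ℤ) / 2) := by
  rw [mem_evenPart] at hi
  have h1 := u.2 i
  rw [domino_apply_self]
  split_ifs with h
  · obtain ⟨k, hk⟩ := h
    omega
  · rw [Int.not_odd_iff_even] at h
    obtain ⟨k, hk⟩ := h
    omega

theorem domino_mem {m : Fin d → ℕ} (u : latticeBox m) {i : Fin d} (hi : i ∈ evenPart u) :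
    domino i u.1 ∈ latticeBox m := fun j => by
  by_cases hj : j = i
  · subst hj
    have := domino_bounds u hi
    omega
  · rw [domino_apply_of_ne _ _ hj]
    exact u.2 j

/-- The step from `u` in direction `s` stays in the largest sub-box with even sides. -/
def StepsInside {m : Fin d → ℕ} (s : Fin d × Bool) (u : latticeBox m) : Prop :=
  evenPart u = Finset.univ ∧ 1 ≤ shift s u.1 s.1 ∧ shift s u.1 s.1 ≤ 2 * ((m s.1 : ℤ) / 2)

theorem StepsInside.mem {m : Fin d → ℕ} {s : Fin d × Bool} {u : latticeBox m}
    (h : StepsInside s u) : shift s u.1 ∈ latticeBox m := fun j => by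
  by_cases hj : j = s.1
  · subst hj
    have := h.2
    omega
  · rw [shift_apply_of_ne _ _ hj]
    exact u.2 j

theorem StepsInside.reverse {m : Fin d → ℕ} {s : Fin d × Bool} {u : latticeBox m}
    (h : StepsInside s u) : StepsInside (s.1, !s.2) (⟨shift s u.1, h.mem⟩ : latticeBox m) := by
  refine ⟨Finset.eq_univ_iff_forall.2 fun j => ?_, ?_⟩
  · rw [mem_evenPart]
    by_cases hj : j = s.1
    · subst hj
      exact h.2.2
    · dsimp only
      rw [shift_apply_of_ne _ _ hj, ← mem_evenPart, h.1]
      exact Finset.mem_univ j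
  · dsimp only
    rw [shift_shift, ← mem_evenPart, h.1]
    exact ⟨(u.2 s.1).1, Finset.mem_univ _⟩

theorem evenPart_domino {m : Fin d → ℕ} (u : latticeBox m) {i : Fin d} (hi : i ∈ evenPart u) :
    evenPart (⟨domino i u.1, domino_mem u hi⟩ : latticeBox m) = evenPart u := by
  ext j
  by_cases hj : j = i
  · subst hj
    simp only [hi, iff_true]
    exact mem_evenPart.2 (domino_bounds u hi).2
  · rw [mem_evenPart, mem_evenPart]
    dsimp only
    rw [domino_apply_of_ne _ _ hj]

/-- Whether a step leaves the even sub-box depends only on the coordinate `s.1`, which a domino in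
another direction does not change. -/
theorem stepsInside_domino {m : Fin d → ℕ} {s : Fin d × Bool} (u : latticeBox m) {i : Fin d}
    (hi : i ∈ evenPart u) (h : evenPart u = Finset.univ → i ≠ s.1) :
    StepsInside s (⟨domino i u.1, domino_mem u hi⟩ : latticeBox m) ↔ StepsInside s u := by
  unfold StepsInside
  rw [evenPart_domino u hi]
  refine and_congr_right fun hu => ?_
  dsimp only
  rw [shift_apply_self, shift_apply_self, domino_apply_of_ne _ _ (h hu).symm]

/-- A rule that chooses one of the given coordinates, other than `i` if all are allowed. -/
structure ReflectionRule (d : ℕ) where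
  rule : Fin d → Finset (Fin d) → Fin d
  rule_mem : ∀ i J, J.Nonempty → rule i J ∈ J
  rule_ne : ∀ i, rule i Finset.univ ≠ i

theorem exists_reflectionRule (hd : 2 ≤ d) : Nonempty (ReflectionRule d) := by
  classical
  have : Nontrivial (Fin d) := Fin.nontrivial_iff_two_le.2 hd
  choose f hf using fun i : Fin d => exists_ne i
  refine ⟨⟨fun i J => if J = Finset.univ then f i else if h : J.Nonempty then h.choose else i,
    fun i J hJ => ?_, fun i => by simpa using hf i⟩⟩
  split_ifs with h
  · rw [h]
    exact Finset.mem_univ _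
  · exact hJ.choose_spec

variable (R : ReflectionRule d) (m : Fin d → ℕ)

open scoped Classical in
/-- A dart system on the box without loops, except at a single site if all sides are odd. Darts
that leave the largest even sub-box are replaced by dominoes along its boundary, and the remaining
sites are paired by dominoes. -/
noncomputable def reflectingDarts : DartSystem (latticeBox m) (Fin d × Bool) where
  next s u := if h : StepsInside s u then ⟨shift s u.1, h.mem⟩
    else if h : (evenPart u).Nonempty then
      ⟨domino (R.rule s.1 (evenPart u)) u.1, domino_mem u (R.rule_mem _ _ h)⟩
    else u
  back s u := if StepsInside s u then (s.1, !s.2) else s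
  next_back s u := by
    by_cases h : StepsInside s u
    · simp only [h, if_true, dif_pos, h.reverse, shift_shift]
    · by_cases h' : (evenPart u).Nonempty
      · have hi := R.rule_mem s.1 _ h'
        -- The domino partner has the same `evenPart` and the same blocked label, so it applies the
        -- same domino, and dominoes are involutions: the dart is reversed with its label kept.
        have h1 := stepsInside_domino (s := s) u hi fun hu => by
          rw [hu]
          exact R.rule_ne s.1
        have h2 := evenPart_domino u hi
        simp only [h, if_false, dif_neg, not_false_eq_true, h', dif_pos, h1, h2, domino_domino]
      · simp only [h, if_false, dif_neg, not_false_eq_true, h']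
  back_back s u := by
    by_cases h : StepsInside s u
    · simp only [h, if_true, dif_pos, h.reverse, Bool.not_not]
    · by_cases h' : (evenPart u).Nonempty
      · have hi := R.rule_mem s.1 _ h'
        have h1 := stepsInside_domino (s := s) u hi fun hu => by
          rw [hu]
          exact R.rule_ne s.1
        simp only [h, if_false, dif_neg, not_false_eq_true, h', dif_pos, h1]
      · simp only [h, if_false, dif_neg, not_false_eq_true, h']

variable {m}

theorem reflectingDarts_next_eq_or_adj (s : Fin d × Bool) (u : latticeBox m) :
    (reflectingDarts R m).next s u = u ∨ (boxGraph m).Adj u ((reflectingDarts R m).next s u) := by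
  by_cases h : StepsInside s u
  · exact Or.inr (adj_of_eq_shift (s := s) (by simp [reflectingDarts, h]))
  · by_cases h' : (evenPart u).Nonempty
    · refine Or.inr (adj_of_eq_add_single (i := R.rule s.1 (evenPart u))
        (ε := if Odd (u.1 (R.rule s.1 (evenPart u))) then 1 else -1) ?_ ?_)
      · split_ifs <;> simp
      · simp [reflectingDarts, h, h', domino]
    · exact Or.inl (by simp [reflectingDarts, h, h'])

theorem reflectingDarts_next_ne {u : latticeBox m} (hu : (evenPart u).Nonempty)
    (s : Fin d × Bool) : (reflectingDarts R m).next s u ≠ u := by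
  intro heq
  have heq := congrArg Subtype.val heq
  by_cases h : StepsInside s u
  · exact shift_ne_self s u.1 (by simpa [reflectingDarts, h] using heq)
  · exact domino_ne_self _ u.1 (by simpa [reflectingDarts, h, hu] using heq)

theorem reflectingDarts_next_of_notMem {u : latticeBox m} (hu : u ∉ boundaryLayer m)
    (s : Fin d × Bool) : ((reflectingDarts R m).next s u).1 = shift s u.1 := by
  have h : StepsInside s u := by
    refine ⟨Finset.eq_univ_iff_forall.2 fun j => ?_, ?_⟩
    · rw [mem_evenPart]
      have := notMem_boundaryLayer.1 hu j
      omega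
    · have := shift_mem_of_notMem_boundaryLayer hu s s.1
      omega
  simp [reflectingDarts, h]

/-- Only the corner with all coordinates maximal and all sides odd can have loops. Then the volume
is odd, so `2 * k` is at most the volume minus 1, which the other rows supply. -/
theorem two_mul_le_sum_reflectingDarts_weight (hd : 1 ≤ d) {k : ℕ} (hk : 2 * k ≤ ∏ i, m i) :
    (2 * k : ℝ) ≤ ∑ u, ∑ v, (reflectingDarts R m).weight s(u, v) := by
  have : NeZero d := ⟨by omega⟩
  have hrow : ∀ u : latticeBox m, (evenPart u).Nonempty →
      ∑ v, (reflectingDarts R m).weight s(u, v) = 1 := fun u hu =>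
    (reflectingDarts R m).sum_weight_eq_one (reflectingDarts_next_ne R hu)
  have hN : ((∏ i, m i : ℕ) : ℝ) = ∑ u : latticeBox m, (1 : ℝ) := by
    rw [← card_latticeBox]
    simp
  by_cases hc : ∃ u₀ : latticeBox m, ¬ (evenPart u₀).Nonempty
  · obtain ⟨u₀, hu₀⟩ := hc
    have hcorner : ∀ u : latticeBox m, ¬ (evenPart u).Nonempty → ∀ i, Odd (m i) ∧ u.1 i = m i := by
      intro u hu i
      rw [Finset.not_nonempty_iff_eq_empty] at hu
      have h1 : i ∉ evenPart u := by simp [hu]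
      rw [mem_evenPart] at h1
      have h2 := u.2 i
      exact ⟨Nat.odd_iff.2 (by omega), by omega⟩
    have hodd : Odd (∏ i, m i) :=
      Finset.prod_induction _ Odd (fun _ _ => Odd.mul) odd_one fun i _ => (hcorner u₀ hu₀ i).1
    have hk' : 2 * k + 1 ≤ ∏ i, m i := by
      obtain ⟨q, hq⟩ := hodd
      omega
    have hk'' : (2 * k + 1 : ℝ) ≤ ((∏ i, m i : ℕ) : ℝ) := by exact_mod_cast hk'
    rw [hN, ← Finset.add_sum_erase _ _ (Finset.mem_univ u₀)] at hk''
    rw [← Finset.add_sum_erase _ _ (Finset.mem_univ u₀)]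
    have h0 : 0 ≤ ∑ v, (reflectingDarts R m).weight s(u₀, v) :=
      Finset.sum_nonneg fun v _ => (reflectingDarts R m).weight_nonneg _
    have h1 : ∑ u ∈ Finset.univ.erase u₀, ∑ v, (reflectingDarts R m).weight s(u, v) =
        ∑ u ∈ (Finset.univ : Finset (latticeBox m)).erase u₀, (1 : ℝ) := by
      refine Finset.sum_congr rfl fun u hu => hrow u ?_
      by_contra h
      refine Finset.ne_of_mem_erase hu (Subtype.ext (funext fun i => ?_))
      rw [(hcorner u h i).2, (hcorner u₀ hu₀ i).2]
    linarith
  · push Not at hc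
    rw [Finset.sum_congr rfl fun u _ => hrow u (hc u), ← hN]
    exact_mod_cast hk

end Reflecting

/-! ### Passage to the limit along growing boxes. -/

section Asymptotics

variable {d : ℕ}

theorem log_numTilings_ge {m : Fin d → ℕ} (hd : 1 ≤ d)
    (T : DartSystem (latticeBox m) (Fin d × Bool))
    (hadj : ∀ s u, T.next s u = u ∨ (boxGraph m).Adj u (T.next s u))
    (hshift : ∀ s, ∀ u ∉ boundaryLayer m, (T.next s u).1 = shift s u.1) {s L : ℝ} {k : ℕ}
    (hs : 0 < s) (hs1 : s ≤ 1) (hk : s * ∑ u, ∑ v, T.weight s(u, v) = 2 * k) (hL : L ≤ 0)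
    (hsL : 1 - s ≤ Real.exp L) (hm : 0 < ∏ i, m i) :
    (∏ i, (m i : ℝ)) * (d * ((1 - s / (2 * d)) * Real.log (1 - s / (2 * d))))
      - (boundaryLayer m).card - 1 - Real.log (∏ i, (m i : ℝ))
      - Real.log (s / (2 * d)) * (k - (boundaryLayer m).card)
      - L * (∏ i, (m i : ℝ) - 2 * k - (boundaryLayer m).card) ≤ Real.log (numTilings m k) := by
  have hd0 : (1 : ℝ) ≤ d := by exact_mod_cast hd
  have : NeZero d := ⟨by omega⟩
  have hσ : (Fintype.card (Fin d × Bool) : ℝ) = 2 * d := by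
    simp [mul_comm]
  have hedge : ∀ u v, T.weight s(u, v) ≠ 0 → (boxGraph m).Adj u v := fun u v h => by
    obtain ⟨huv, s, rfl⟩ := T.exists_next_of_weight_ne_zero h
    exact (hadj s u).resolve_left huv.symm
  have hinj : ∀ u ∉ boundaryLayer m, Function.Injective fun s => T.next s u := fun u hu a b hab =>
    shift_injective u.1 (by
      dsimp only
      rw [← hshift a u hu, ← hshift b u hu]
      exact congrArg Subtype.val hab)
  have hbound := log_card_supportPairings_ge (x₀ := T.weight) T.weight_nonneg siteColor
    (fun u v h => by
      by_contra h'
      exact siteColor_ne_of_adj (hedge u v h') h)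
    T.sum_weight_le_one (boundaryLayer m)
    (fun u hu => T.sum_weight_eq_one fun a ha => shift_ne_self a u.1 (by
      rw [← hshift a u hu, ha]))
    (δ := 1 / (2 * d)) (by positivity) hs hs1
    (by
      rw [mul_one_div, div_lt_one (by positivity)]
      linarith)
    (fun e he => by
      induction e with
      | h u v =>
        rw [← hσ]
        exact T.weight_eq_zero_or (hinj u (he u (Sym2.mem_mk_left u v))) v)
    hk hL hsL (by rwa [card_latticeBox])
  have hle : Real.log (supportPairings T.weight k).card ≤ Real.log (numTilings m k) := by
    rcases Nat.eq_zero_or_pos (supportPairings T.weight k).card with h | h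
    · rw [h]
      simpa using Real.log_natCast_nonneg _
    · refine Real.log_le_log (by exact_mod_cast h) ?_
      exact_mod_cast card_supportPairings_le (fun e => by
        induction e with
        | h u v => exact hedge u v) k
  refine le_trans (le_of_eq ?_) (hbound.trans hle)
  rw [card_latticeBox, mul_one_div s]
  push_cast
  have : (∏ i, (m i : ℝ)) / (2 * (1 / (2 * (d : ℝ)))) = (∏ i, (m i : ℝ)) * d := by
    field_simp
  rw [this]
  ring

theorem tendsto_side_densityFilter (d : ℕ) (p : ℝ) (i : Fin d) :
    Tendsto (fun x : (Fin d → ℕ) × ℕ => x.1 i) (densityFilter d p) atTop := by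
  have h : Tendsto (fun x : (Fin d → ℕ) × ℕ => x.1) (densityFilter d p)
      (Filter.pi fun _ => atTop) :=
    tendsto_comap.mono_left (inf_le_left.trans inf_le_left)
  exact tendsto_pi.1 h i

theorem tendsto_density_densityFilter (d : ℕ) (p : ℝ) :
    Tendsto (fun x : (Fin d → ℕ) × ℕ => (2 * x.2 : ℝ) / ∏ i, (x.1 i : ℝ)) (densityFilter d p)
      (𝓝 p) :=
  tendsto_comap.mono_left (inf_le_left.trans inf_le_right)

theorem eventually_le_densityFilter (d : ℕ) (p : ℝ) :
    ∀ᶠ x : (Fin d → ℕ) × ℕ in densityFilter d p, 2 * x.2 ≤ ∏ i, x.1 i :=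
  mem_of_superset (mem_inf_of_right (mem_principal_self _)) fun _ h => h

theorem eventually_sides_pos (d : ℕ) (p : ℝ) :
    ∀ᶠ x : (Fin d → ℕ) × ℕ in densityFilter d p, ∀ i, 0 < x.1 i :=
  eventually_all.2 fun i => (tendsto_side_densityFilter d p i).eventually_gt_atTop 0

theorem tendsto_volume_densityFilter (hd : 1 ≤ d) (p : ℝ) :
    Tendsto (fun x : (Fin d → ℕ) × ℕ => ∏ i, (x.1 i : ℝ)) (densityFilter d p) atTop := by
  have h1 : Tendsto (fun x : (Fin d → ℕ) × ℕ => ∏ i, x.1 i) (densityFilter d p) atTop := by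
    refine tendsto_atTop_mono' _ ?_ (tendsto_side_densityFilter d p ⟨0, hd⟩)
    filter_upwards [eventually_sides_pos d p] with x hx
    exact Nat.le_of_dvd (Finset.prod_pos fun i _ => hx i)
      (Finset.dvd_prod_of_mem x.1 (Finset.mem_univ _))
  refine (tendsto_natCast_atTop_atTop.comp h1).congr fun x => ?_
  simp

theorem tendsto_boundaryLayer_densityFilter (d : ℕ) (p : ℝ) :
    Tendsto (fun x : (Fin d → ℕ) × ℕ => ((boundaryLayer x.1).card : ℝ) / ∏ i, (x.1 i : ℝ))
      (densityFilter d p) (𝓝 0) := by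
  have h1 : Tendsto (fun n : ℕ => ((n - 3 : ℕ) : ℝ) / n) atTop (𝓝 1) := by
    have h := (tendsto_const_div_atTop_nhds_zero_nat (3 : ℝ)).const_sub 1
    rw [sub_zero] at h
    refine h.congr' ?_
    filter_upwards [eventually_ge_atTop 3] with n hn
    have : (n : ℝ) ≠ 0 := by
      have : n ≠ 0 := by omega
      exact_mod_cast this
    rw [Nat.cast_sub hn, sub_div, div_self this]
    simp
  have h2 : Tendsto (fun x : (Fin d → ℕ) × ℕ => 1 - ∏ i, (((x.1 i - 3 : ℕ) : ℝ) / (x.1 i : ℝ)))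
      (densityFilter d p) (𝓝 (1 - ∏ _i : Fin d, (1 : ℝ))) :=
    (tendsto_finsetProd _ fun i _ => h1.comp (tendsto_side_densityFilter d p i)).const_sub 1
  rw [Finset.prod_const_one, sub_self] at h2
  refine h2.congr' ?_
  filter_upwards [eventually_sides_pos d p] with x hx
  have h3 : ((boundaryLayer x.1).card : ℝ) = ∏ i, (x.1 i : ℝ) - ∏ i, ((x.1 i - 3 : ℕ) : ℝ) := by
    rw [eq_sub_iff_add_eq]
    exact_mod_cast card_boundaryLayer x.1
  have h4 : ∏ i, (x.1 i : ℝ) ≠ 0 := Finset.prod_ne_zero_iff.2 fun i _ => by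
    exact_mod_cast (hx i).ne'
  rw [h3, sub_div, div_self h4, Finset.prod_div_distrib]

theorem le_monomerDimerEntropy (hd : 1 ≤ d) {p : ℝ} (hp : p ∈ Set.Icc (0 : ℝ) 1) {h : ℝ}
    {G : (Fin d → ℕ) × ℕ → ℝ} (hG : Tendsto G (densityFilter d p) (𝓝 h))
    (hle : ∀ᶠ x in densityFilter d p,
      G x ≤ Real.log (numTilings x.1 x.2) / ∏ i, (x.1 i : ℝ)) :
    h ≤ monomerDimerEntropy d p := by
  have := densityFilter_neBot hd hp
  rw [← hG.liminf_eq]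
  refine liminf_le_liminf hle hG.isBoundedUnder_ge ?_
  -- A lower limit in `ℝ` is monotone only under a boundedness condition, supplied by
  -- `numTilings_le`.
  refine IsBoundedUnder.isCoboundedUnder_ge (isBoundedUnder_of ⟨2 * d * Real.log 2, fun x => ?_⟩)
  refine div_le_of_le_mul₀ (by positivity) (by positivity) ?_
  rcases Nat.eq_zero_or_pos (numTilings x.1 x.2) with h0 | h0
  · rw [h0]
    simp only [Nat.cast_zero, Real.log_zero]
    positivity
  · have h1 : (numTilings x.1 x.2 : ℝ) ≤ (2 ^ (2 * d)) ^ ∏ i, x.1 i := by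
      exact_mod_cast numTilings_le x.1 x.2
    refine (Real.log_le_log (by exact_mod_cast h0) h1).trans_eq ?_
    rw [Real.log_pow, Real.log_pow]
    push_cast
    ring

theorem sum_weight_bounds {m : Fin d → ℕ} (hd : 1 ≤ d)
    (T : DartSystem (latticeBox m) (Fin d × Bool))
    (hshift : ∀ s, ∀ u ∉ boundaryLayer m, (T.next s u).1 = shift s u.1) :
    ∏ i, (m i : ℝ) - (boundaryLayer m).card ≤ ∑ u, ∑ v, T.weight s(u, v) ∧
      ∑ u, ∑ v, T.weight s(u, v) ≤ ∏ i, (m i : ℝ) := by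
  have : NeZero d := ⟨by omega⟩
  have hN : ∏ i, (m i : ℝ) = ∑ u : latticeBox m, (1 : ℝ) := by
    rw [Finset.sum_const, Finset.card_univ, card_latticeBox]
    simp
  constructor
  · rw [hN, sub_le_iff_le_add]
    have hX : ((boundaryLayer m).card : ℝ) = ∑ u, if u ∈ boundaryLayer m then (1 : ℝ) else 0 := by
      simp
    rw [hX, ← Finset.sum_add_distrib]
    refine Finset.sum_le_sum fun u _ => ?_
    split_ifs with hu
    · have := Finset.sum_nonneg fun v (_ : v ∈ Finset.univ) => T.weight_nonneg s(u, v)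
      linarith
    · rw [T.sum_weight_eq_one fun a ha => shift_ne_self a u.1 (by rw [← hshift a u hu, ha])]
      simp
  · rw [hN]
    exact Finset.sum_le_sum fun u _ => T.sum_weight_le_one u

variable (T : ∀ m : Fin d → ℕ, DartSystem (latticeBox m) (Fin d × Bool))

/-- The ratio by which the fractional matching given by the dart system has to be scaled to obtain
total weight `ℓ`. -/
noncomputable def scaling (x : (Fin d → ℕ) × ℕ) : ℝ :=
  2 * x.2 / ∑ u, ∑ v, (T x.1).weight s(u, v)

variable {T}

theorem tendsto_scaling (hd : 1 ≤ d) (p : ℝ)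
    (hshift : ∀ m, ∀ s, ∀ u ∉ boundaryLayer m, ((T m).next s u).1 = shift s u.1) :
    Tendsto (scaling T) (densityFilter d p) (𝓝 p) := by
  have hN := tendsto_volume_densityFilter hd p
  have h1 : Tendsto (fun x : (Fin d → ℕ) × ℕ =>
      (∑ u, ∑ v, (T x.1).weight s(u, v)) / ∏ i, (x.1 i : ℝ)) (densityFilter d p) (𝓝 1) := by
    have h2 := (tendsto_boundaryLayer_densityFilter d p).const_sub 1
    rw [sub_zero] at h2
    refine tendsto_of_tendsto_of_tendsto_of_le_of_le' h2 tendsto_const_nhds ?_ ?_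
    · filter_upwards [hN.eventually_gt_atTop 0] with x hx
      rw [le_div_iff₀ hx, sub_mul, div_mul_cancel₀ _ hx.ne', one_mul]
      exact (sum_weight_bounds hd (T x.1) (hshift x.1)).1
    · filter_upwards [hN.eventually_gt_atTop 0] with x hx
      rw [div_le_one hx]
      exact (sum_weight_bounds hd (T x.1) (hshift x.1)).2
  have h3 := (tendsto_density_densityFilter d p).div h1 one_ne_zero
  rw [div_one] at h3
  refine h3.congr' ?_
  filter_upwards [hN.eventually_gt_atTop 0] with x hx
  rw [Pi.div_apply, div_div_div_cancel_right₀ hx.ne', scaling]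

/-- Per site, the boundary layer and the Stirling loss vanish and the scaling tends to `p`. The
function `L` bounds the logarithmic monomer weight `log (1 - s)`; it is left free because that
logarithm is not continuous at `s = 1`. -/
theorem le_monomerDimerEntropy_of_darts (hd : 1 ≤ d) {p : ℝ} (hp0 : 0 < p) (hp1 : p ≤ 1)
    (hadj : ∀ m, ∀ s u, (T m).next s u = u ∨ (boxGraph m).Adj u ((T m).next s u))
    (hshift : ∀ m, ∀ s, ∀ u ∉ boundaryLayer m, ((T m).next s u).1 = shift s u.1)
    (hle : ∀ᶠ x in densityFilter d p, scaling T x ≤ 1) {L : ℝ → ℝ} (hLc : ContinuousAt L p)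
    (hL : ∀ s, 0 < s → s ≤ 1 → L s ≤ 0 ∧ 1 - s ≤ Real.exp (L s)) :
    d * ((1 - p / (2 * d)) * Real.log (1 - p / (2 * d))) - Real.log (p / (2 * d)) * (p / 2)
      - L p * (1 - p) ≤ monomerDimerEntropy d p := by
  have hd0 : (1 : ℝ) ≤ d := by exact_mod_cast hd
  have hN := tendsto_volume_densityFilter hd p
  have hX := tendsto_boundaryLayer_densityFilter d p
  have hk := tendsto_density_densityFilter d p
  have hs := tendsto_scaling hd p hshift
  have hs2 := hs.div_const (2 * (d : ℝ))
  have hp2 : p / (2 * d) < 1 := by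
    rw [div_lt_one (by positivity)]
    linarith
  have h1s := hs2.const_sub 1
  have hlogN : Tendsto (fun x : (Fin d → ℕ) × ℕ => Real.log (∏ i, (x.1 i : ℝ)) /
      ∏ i, (x.1 i : ℝ)) (densityFilter d p) (𝓝 0) := by
    have := (Real.isLittleO_log_id_atTop).tendsto_div_nhds_zero
    exact this.comp hN
  have hG := ((((((h1s.mul (h1s.log (by linarith))).const_mul (d : ℝ)).sub hX).sub
    (tendsto_inv_atTop_zero.comp hN)).sub hlogN).sub
    ((hs2.log (by positivity)).mul ((hk.div_const 2).sub hX))).sub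
    ((hLc.tendsto.comp hs).mul ((hk.const_sub 1).sub hX))
  simp only [sub_zero] at hG
  refine le_monomerDimerEntropy hd ⟨hp0.le, hp1⟩ hG ?_
  filter_upwards [hle, hN.eventually_gt_atTop 0, hs.eventually_const_lt hp0,
    eventually_sides_pos d p] with x hx1 hx2 hx3 hx4
  have hS : (∑ u, ∑ v, (T x.1).weight s(u, v)) ≠ 0 := fun h0 => by
    rw [scaling, h0, div_zero] at hx3
    exact hx3.false
  have hmain := log_numTilings_ge hd (T x.1) (hadj x.1) (hshift x.1) (k := x.2) hx3 hx1
    (by rw [scaling, div_mul_cancel₀ _ hS]) (hL _ hx3 hx1).1 (hL _ hx3 hx1).2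
    (Finset.prod_pos fun i _ => hx4 i)
  rw [le_div_iff₀ hx2]
  refine le_trans (le_of_eq ?_) hmain
  simp only [Function.comp_apply]
  field_simp

end Asymptotics

theorem theorem6p1 (d : ℕ) (hd : 1 ≤ d) (p : ℝ) (hp : p ∈ Set.Icc (0 : ℝ) 1) :
    (1 / 2 : ℝ) * (p * Real.log (2 * d) - p * Real.log p - 2 * (1 - p) * Real.log (1 - p)
      + (2 * d - p) * Real.log (1 - p / (2 * d))) ≤ monomerDimerEntropy d p := by
  have hd0 : (1 : ℝ) ≤ d := by exact_mod_cast hd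
  have htriv : 0 ≤ monomerDimerEntropy d p :=
    le_monomerDimerEntropy hd hp tendsto_const_nhds (Eventually.of_forall fun x =>
      div_nonneg (Real.log_natCast_nonneg _) (by positivity))
  rcases hp.1.eq_or_lt with rfl | hp0
  · simpa using htriv
  have hrw : (1 / 2 : ℝ) * (p * Real.log (2 * d) - p * Real.log p
      - 2 * (1 - p) * Real.log (1 - p) + (2 * d - p) * Real.log (1 - p / (2 * d))) =
      d * ((1 - p / (2 * d)) * Real.log (1 - p / (2 * d))) - Real.log (p / (2 * d)) * (p / 2)
      - Real.log (1 - p) * (1 - p) := by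
    rw [Real.log_div hp0.ne' (by positivity)]
    field_simp
    ring
  rcases hp.2.eq_or_lt with rfl | hp1
  · rcases hd.eq_or_lt with rfl | hd2
    · refine le_of_eq_of_le ?_ htriv
      norm_num
      rw [Real.log_div one_ne_zero two_ne_zero]
      simp
    · obtain ⟨R⟩ := exists_reflectionRule hd2
      rw [hrw]
      have h := le_monomerDimerEntropy_of_darts (T := reflectingDarts R) hd hp0 le_rfl
        (fun m => reflectingDarts_next_eq_or_adj R)
        (fun m s u hu => reflectingDarts_next_of_notMem R hu s)
        (by
          filter_upwards [eventually_le_densityFilter d 1] with x hx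
          exact div_le_one_of_le₀ (two_mul_le_sum_reflectingDarts_weight R hd hx)
            (Finset.sum_nonneg fun u _ => Finset.sum_nonneg fun v _ =>
              (reflectingDarts R x.1).weight_nonneg _))
        -- At density 1 the monomers have vanishing density, so bounding their weights by 1 loses
        -- nothing in the limit.
        (L := fun _ => 0) continuousAt_const (fun s hs _ => ⟨le_rfl, by
          rw [Real.exp_zero]
          linarith⟩)
      simpa using h
  · rw [hrw]
    refine le_monomerDimerEntropy_of_darts (T := freeDarts) (L := fun s => Real.log (1 - s)) hd hp0
      hp1.le freeDarts_next_eq_or_adj (fun m s u hu => freeDarts_next_of_notMem hu s) ?_ ?_ ?_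
    -- Since the scaling tends to `p < 1`, the weight lost at the boundary does no harm.
    · exact (tendsto_scaling hd p fun m s u hu => freeDarts_next_of_notMem hu s).eventually_le_const
        hp1
    · exact (continuousAt_const.sub continuousAt_id).log (by simpa using by linarith)
    · intro s hs hs1
      refine ⟨Real.log_nonpos (by linarith) (by linarith), ?_⟩
      -- At `s = 1` the convention `Real.log 0 = 0` turns the claim into `0 ≤ 1`.
      rcases hs1.eq_or_lt with rfl | hs1
      · simp
      · rw [Real.exp_log (by linarith)]
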